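/- In this statement digraphs are labelled, may have loops (a loop contributes $1$ to the in-degree and $1$ to the out-degree of its vertex) and have no multiple arcs. For positive integers $n,m$ let $\mathcal G_{1,1}(n,m)$ be the set of digraphs on the vertex set $\{1,\dots,n\}$ with exactly $m$ arcs in which every in-degree and every out-degree is at least $1$. For every real $c>1$ the equation $$c=\frac{\lambda e^{\lambda}}{e^{\lambda}-1}$$ has a unique positive root $\lambda=\lambda(c)$. As $n\to\infty$, uniformly for $m=O(n\log n)$ and $m-n\to\infty$, $$|\mathcal G_{1,1}(n,m)|\sim \frac{m!\,(e^{\lambda}-1)^{2n}}{2\pi n c(1+\lambda-c)\lambda^{2m}}\exp(-\lambda^2/2),\qquad c=\frac mn,\ \lambda=\lambda(c).$$ That is: for all real $C>0$ and $\varepsilon>0$ there are $N$ and $R$ such that for all integers $n\ge N$ and $m$ with $n+R\le m\le Cn\log n$ (and $m>n$, so that $c>1$) the quotient of the left side by the right side differs from $1$ by less than $\varepsilon$. -/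

import Mathlib

namespace Dicore

/-- The set of arcs of a digraph (loops are allowed, multiple arcs are not). -/
def arcs {V : Type*} (G : Digraph V) : Set (V × V) := {p | G.Adj p.1 p.2}

/-- The out-degree of a vertex; a loop counts once. -/
noncomputable def outdeg {V : Type*} (G : Digraph V) (v : V) : ℕ := {w | G.Adj v w}.ncard

/-- The in-degree of a vertex; a loop counts once. -/
noncomputable def indeg {V : Type*} (G : Digraph V) (v : V) : ℕ := {u | G.Adj u v}.ncard

/-- The set of digraphs on `n` labelled vertices with `m` arcs
in which all in-degrees and out-degrees are at least `1`. -/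
def dicores (n m : ℕ) : Set (Digraph (Fin n)) :=
  {G | (arcs G).ncard = m ∧ ∀ v, 1 ≤ outdeg G v ∧ 1 ≤ indeg G v}

/-- `lam` is a positive root of `c = lam * e ^ lam / (e ^ lam - 1)`. -/
def IsParam (c lam : ℝ) : Prop :=
  0 < lam ∧ c = lam * Real.exp lam / (Real.exp lam - 1)

/-- The asymptotic formula for the number of dicores, with `c = m / n`. -/
noncomputable def formula (n m : ℕ) (lam : ℝ) : ℝ :=
  let c : ℝ := (m : ℝ) / n
  (m.factorial : ℝ) * (Real.exp lam - 1) ^ (2 * n) /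
      (2 * Real.pi * n * c * (1 + lam - c) * lam ^ (2 * m)) *
    Real.exp (-lam ^ 2 / 2)

end Dicore

/-! ### Exact count by inclusion–exclusion. -/

namespace Dicore

open Finset

/-! A digraph is a 0/1 matrix, and a dicore is one with no zero row and no zero column.
Inclusion–exclusion over rows and columns gives a double sum of `(i * j).choose m`. Expanding the
falling factorial of `i * j` in powers makes rows and columns separate, so each power contributes
the square of a surjection number `altSum` (`factorial_mul_ncard_dicores`).

These numbers are Taylor coefficients of `(e^x - 1)^n`. Cauchy integrals over the circle of radius
`lam`, the saddle point, turn the count into one double integral (`ncard_dicores_eq_integral`). Its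
integrand is the product of two `n`-th powers of the characteristic function `chi` of the
zero-truncated Poisson law with mean `c`, a centring phase, and `simpleFactor`, which accounts for
the ban on multiple arcs.

Without `simpleFactor` the integral is a square, and each factor obeys a local limit theorem with
variance `n * c * (1 + lam - c)` (`tendsto_integral_mul_sqrt`); this yields the denominator of the
formula.

`simpleFactor` tends to `exp (-lam^2 / 2)` near the saddle. With `m^(-2j)` in place of the squared
factorial ratios it would be `∏ (1 - i z / m^2)`, which is about `exp (-z / 2)`. The ratios are
restored by averaging twice over a Gamma variable concentrated at `m` (`norm_gammaAverage_le`,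
`norm_simpleFactor_mul_exp_sub_one_le`). Away from the saddle a crude bound on `simpleFactor`
suffices, because `chi` decays like a Gaussian (`norm_chi_le`, `exists_error_bound`).

Uniformity is handled by sequences: a failure would give a sequence of bad parameters, but the
quotient tends to 1 along every `Admissible` sequence. -/

/-- The alternating sum `∑ i, (-1) ^ (n - i) * choose n i * i ^ k`, which counts surjections from a
`k`-element set onto an `n`-element set. -/
noncomputable def altSum (n k : ℕ) : ℂ :=
  ∑ i ∈ range (n + 1), (-1) ^ (n - i) * (n.choose i : ℂ) * (i : ℂ) ^ k

/-- The coefficients of the falling factorial: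
`∏ l < m, (x - l) = ∑ j, fallCoeff m j * x ^ (m - j)`. -/
noncomputable def fallCoeff (m j : ℕ) : ℂ :=
  ∑ t ∈ powersetCard j (range m), ∏ i ∈ t, (-(i : ℂ))

/-- The arc sets of dicores. -/
def coverSets (n m : ℕ) : Finset (Finset (Fin n × Fin n)) :=
  (powersetCard m univ).filter fun S => (∀ v, ∃ w, (v, w) ∈ S) ∧ ∀ v, ∃ u, (u, v) ∈ S

theorem ncard_dicores (n m : ℕ) : (dicores n m).ncard = #(coverSets n m) := by
  classical
  rw [← Set.ncard_coe_finset]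
  symm
  refine Set.ncard_congr (fun S _ => ⟨fun u v => (u, v) ∈ S⟩) ?_ ?_ ?_
  · intro S hS
    simp only [coverSets, coe_filter, mem_powersetCard_univ, Set.mem_ofPred_eq] at hS
    refine ⟨?_, fun v => ⟨?_, ?_⟩⟩
    · simp only [arcs, Prod.mk.eta]
      rw [← hS.1, ← Set.ncard_coe_finset]
      rfl
    · rw [Nat.one_le_iff_ne_zero, outdeg, Ne, Set.ncard_eq_zero, ← Ne, ← Set.nonempty_iff_ne_empty]
      exact hS.2.1 v
    · rw [Nat.one_le_iff_ne_zero, indeg, Ne, Set.ncard_eq_zero, ← Ne, ← Set.nonempty_iff_ne_empty]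
      exact hS.2.2 v
  · intro S T _ _ h
    ext ⟨u, v⟩
    have := congrArg (fun G : Digraph (Fin n) => G.Adj u v) h
    simpa using this
  · intro G hG
    refine ⟨univ.filter fun p => G.Adj p.1 p.2, ?_, by ext; simp⟩
    obtain ⟨h1, h2⟩ := hG
    simp only [coverSets, coe_filter, mem_powersetCard_univ, Set.mem_ofPred_eq, mem_filter, mem_univ,
      true_and]
    refine ⟨?_, fun v => ?_, fun v => ?_⟩
    · rw [← h1, ← Set.ncard_coe_finset]
      simp [arcs]
    · have := (h2 v).1
      rw [Nat.one_le_iff_ne_zero, outdeg, Ne, Set.ncard_eq_zero, ← Ne,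
        ← Set.nonempty_iff_ne_empty] at this
      exact this
    · have := (h2 v).2
      rw [Nat.one_le_iff_ne_zero, indeg, Ne, Set.ncard_eq_zero, ← Ne,
        ← Set.nonempty_iff_ne_empty] at this
      exact this

/-- Inclusion–exclusion in pointwise form: expand the product over `v` of one minus the indicator of
failure at `v`. -/
theorem ite_forall_eq_sum {V : Type*} [Fintype V] [DecidableEq V] (p : V → Prop)
    [Decidable (∀ v, p v)] [∀ A : Finset V, Decidable (∀ v ∈ A, ¬ p v)] :
    (if ∀ v, p v then (1 : ℂ) else 0) =
      ∑ A : Finset V, (-1) ^ #A * if ∀ v ∈ A, ¬ p v then (1 : ℂ) else 0 := by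
  classical
  have h1 : (if ∀ v, p v then (1 : ℂ) else 0) = ∏ v, (1 + -(if ¬ p v then (1 : ℂ) else 0)) := by
    have : ∀ v, (1 + -(if ¬ p v then (1 : ℂ) else 0)) = if p v then 1 else 0 := by
      intro v; split_ifs <;> simp_all
    simp_rw [this, prod_ite_zero, mem_univ, true_imp_iff, prod_const_one]
  rw [h1, prod_one_add, powerset_univ]
  refine sum_congr rfl fun A _ => ?_
  rw [prod_neg, prod_ite_zero, prod_const_one]
  congr

theorem sum_finset_apply_card {n : ℕ} (f : ℕ → ℂ) :
    ∑ A : Finset (Fin n), (-1) ^ #A * f (n - #A) =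
      ∑ i ∈ range (n + 1), (-1) ^ (n - i) * (n.choose i : ℂ) * f i := by
  rw [← powerset_univ, sum_powerset_apply_card (fun a => (-1 : ℂ) ^ a * f (n - a)), card_univ,
    Fintype.card_fin, ← sum_range_reflect]
  refine sum_congr rfl fun i hi => ?_
  have hi' : i ≤ n := by simpa [Nat.lt_succ_iff] using hi
  rw [show n + 1 - 1 - i = n - i by omega, Nat.choose_symm hi', Nat.sub_sub_self hi', nsmul_eq_mul]
  ring

theorem card_coverSets (n m : ℕ) : (#(coverSets n m) : ℂ) =
    ∑ i ∈ range (n + 1), (-1) ^ (n - i) * (n.choose i : ℂ) *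
      ∑ j ∈ range (n + 1), (-1) ^ (n - j) * (n.choose j : ℂ) * ((i * j).choose m : ℂ) := by
  classical
  -- Arc sets leaving the rows in `A` and the columns in `B` empty are the `m`-subsets of the grid
  -- `Aᶜ ×ˢ Bᶜ`.
  have key : ∀ A B : Finset (Fin n),
      ∑ S ∈ powersetCard m (univ : Finset (Fin n × Fin n)),
        ((if ∀ v ∈ A, ¬ ∃ w, (v, w) ∈ S then (1 : ℂ) else 0) *
          if ∀ v ∈ B, ¬ ∃ u, (u, v) ∈ S then (1 : ℂ) else 0) =
      (((n - #A) * (n - #B)).choose m : ℂ) := by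
    intro A B
    have hAB : #(Aᶜ ×ˢ Bᶜ) = (n - #A) * (n - #B) := by simp [card_compl]
    rw [← hAB, ← card_powersetCard]
    simp_rw [ite_zero_mul_ite_zero, mul_one]
    rw [sum_boole]
    congr 2
    ext S
    simp only [mem_filter, mem_powersetCard, subset_univ, true_and, not_exists]
    rw [and_comm]
    refine and_congr_left fun _ =>
      ⟨fun h p hp => ?_, fun h => ⟨fun v hv w hw => ?_, fun v hv u hu => ?_⟩⟩
    · rw [mem_product, mem_compl, mem_compl]
      exact ⟨fun hA => h.1 _ hA _ hp, fun hB => h.2 _ hB _ hp⟩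
    · have := h hw
      simp_all
    · have := h hu
      simp_all
  rw [coverSets, card_filter]
  push_cast
  have h1 : ∀ S : Finset (Fin n × Fin n),
      (if (∀ v, ∃ w, (v, w) ∈ S) ∧ ∀ v, ∃ u, (u, v) ∈ S then (1 : ℂ) else 0) =
      ∑ A : Finset (Fin n), (-1) ^ #A * ∑ B : Finset (Fin n), (-1) ^ #B *
        ((if ∀ v ∈ A, ¬ ∃ w, (v, w) ∈ S then (1 : ℂ) else 0) *
          if ∀ v ∈ B, ¬ ∃ u, (u, v) ∈ S then (1 : ℂ) else 0) := by
    intro S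
    rw [← mul_one (1 : ℂ), ← ite_zero_mul_ite_zero, mul_one,
      ite_forall_eq_sum (fun v => ∃ w, (v, w) ∈ S),
      ite_forall_eq_sum (fun v => ∃ u, (u, v) ∈ S), sum_mul_sum]
    refine sum_congr rfl fun A _ => ?_
    rw [mul_sum]
    refine sum_congr rfl fun B _ => ?_
    ring
  simp_rw [h1]
  rw [sum_comm]
  simp_rw [← mul_sum]
  have h2 : ∀ A : Finset (Fin n),
      ∑ S ∈ powersetCard m (univ : Finset (Fin n × Fin n)), ∑ B : Finset (Fin n), (-1) ^ #B *
        ((if ∀ v ∈ A, ¬ ∃ w, (v, w) ∈ S then (1 : ℂ) else 0) *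
          if ∀ v ∈ B, ¬ ∃ u, (u, v) ∈ S then (1 : ℂ) else 0) =
      ∑ j ∈ range (n + 1), (-1) ^ (n - j) * (n.choose j : ℂ) * (((n - #A) * j).choose m : ℂ) := by
    intro A
    rw [sum_comm]
    simp_rw [← mul_sum, key]
    exact sum_finset_apply_card (fun j => (((n - #A) * j).choose m : ℂ))
  simp_rw [h2]
  exact sum_finset_apply_card (fun i => ∑ j ∈ range (n + 1), (-1) ^ (n - j) * (n.choose j : ℂ) *
    ((i * j).choose m : ℂ))

/-- The homogeneous form serves twice: `y = 1` gives the falling factorial, while `x = 1`, `y = z /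
m^2` gives the product that approximates `exp (-z / 2)`. -/
theorem prod_add_mul_eq_sum_fallCoeff (m : ℕ) (x y : ℂ) :
    ∏ i ∈ range m, (x - i * y) = ∑ j ∈ range (m + 1), fallCoeff m j * y ^ j * x ^ (m - j) := by
  have h : ∀ i : ℕ, x - i * y = -(i : ℂ) * y + x := fun i => by ring
  simp_rw [h]
  rw [prod_add, sum_powerset, card_range]
  refine sum_congr rfl fun j _ => ?_
  rw [fallCoeff, sum_mul, sum_mul]
  refine sum_congr rfl fun t ht => ?_
  rw [mem_powersetCard] at ht
  rw [prod_mul_distrib, prod_const, prod_const, ht.2, card_sdiff_of_subset ht.1, ht.2, card_range]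

theorem factorial_mul_choose_eq_sum (m a : ℕ) : (m.factorial : ℂ) * (a.choose m : ℂ) =
    ∑ j ∈ range (m + 1), fallCoeff m j * (a : ℂ) ^ (m - j) := by
  have := prod_add_mul_eq_sum_fallCoeff m a 1
  simp only [mul_one, one_pow] at this
  rw [← this, ← descPochhammer_eval_eq_prod_range, descPochhammer_eval_eq_descFactorial,
    Nat.descFactorial_eq_factorial_mul_choose]
  push_cast
  rfl

/-- Since `(i * j)^(m - l)` factors, the double sum over `i` and `j` becomes a square for each `l`.
-/
theorem factorial_mul_ncard_dicores (n m : ℕ) :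
    (m.factorial : ℂ) * ((dicores n m).ncard : ℂ) =
      ∑ j ∈ range (m + 1), fallCoeff m j * altSum n (m - j) ^ 2 := by
  rw [ncard_dicores, card_coverSets, mul_sum]
  have h : ∀ i j : ℕ, (m.factorial : ℂ) * ((i * j).choose m : ℂ) =
    ∑ l ∈ range (m + 1), fallCoeff m l * ((i : ℂ) ^ (m - l) * (j : ℂ) ^ (m - l)) := by
    intro i j
    rw [factorial_mul_choose_eq_sum]
    push_cast
    simp_rw [mul_pow]
  calc _ = ∑ i ∈ range (n + 1), ∑ j ∈ range (n + 1), ∑ l ∈ range (m + 1),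
      fallCoeff m l * (((-1) ^ (n - i) * (n.choose i : ℂ) * (i : ℂ) ^ (m - l)) *
        ((-1) ^ (n - j) * (n.choose j : ℂ) * (j : ℂ) ^ (m - l))) := by
        refine sum_congr rfl fun i _ => ?_
        rw [mul_sum, mul_sum]
        refine sum_congr rfl fun j _ => ?_
        calc _ = ((-1) ^ (n - i) * (n.choose i : ℂ)) * ((-1) ^ (n - j) * (n.choose j : ℂ)) *
              ((m.factorial : ℂ) * ((i * j).choose m : ℂ)) := by ring
          _ = _ := by
            rw [h, mul_sum]
            refine sum_congr rfl fun l _ => ?_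
            ring
    _ = _ := by
        simp_rw [sum_comm (s := range (n + 1)) (t := range (m + 1))]
        refine sum_congr rfl fun l _ => ?_
        simp_rw [← mul_sum, altSum, sq, sum_mul_sum]
        simp_rw [mul_sum]

end Dicore

/-! ### The parameter `lam`: existence, uniqueness, and bounds for mean and variance. -/

namespace Dicore

open Real

theorem isParam_iff {c lam : ℝ} :
    IsParam c lam ↔ 0 < lam ∧ c * (exp lam - 1) = lam * exp lam := by
  unfold IsParam
  refine and_congr_right fun h => ?_
  have : 0 < exp lam - 1 := by linarith [add_one_lt_exp h.ne']
  rw [eq_div_iff this.ne']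

/-- The quotient is the slope of a secant of `exp` from `-x` to `0`, so strict convexity applies.
The parameter equation says that this quotient is `1 / c`. -/
theorem strictAntiOn_param : StrictAntiOn (fun x : ℝ => (1 - exp (-x)) / x) (Set.Ioi 0) := by
  intro a ha b hb hab
  simp only [Set.mem_Ioi] at ha hb
  have h := strictConvexOn_exp.secant_strict_mono (a := 0) (x := -b) (y := -a) (Set.mem_univ _)
    (Set.mem_univ _) (Set.mem_univ _) (by linarith) (by linarith) (by linarith)
  simp only [exp_zero, sub_zero] at h
  have e : ∀ x : ℝ, (exp (-x) - 1) / (-x) = (1 - exp (-x)) / x := fun x => by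
    rw [div_neg, ← neg_div, neg_sub]
  rwa [e, e] at h

theorem isParam_unique {c x y : ℝ} (hx : IsParam c x) (hy : IsParam c y) : x = y := by
  have key : ∀ z, IsParam c z → (1 - exp (-z)) / z = c⁻¹ := by
    intro z hz
    have h1 : 0 < exp z - 1 := by linarith [add_one_lt_exp hz.1.ne', hz.1]
    have hz0 := hz.1
    rw [hz.2, exp_neg]
    field_simp
  exact strictAntiOn_param.injOn hx.1 hy.1 ((key x hx).trans (key y hy).symm)

theorem existsUnique_isParam {c : ℝ} (hc : 1 < c) : ∃! lam : ℝ, IsParam c lam := by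
  have hcont : ContinuousOn (fun x : ℝ => x * exp x / (exp x - 1)) (Set.Icc (c - 1) c) := by
    refine ContinuousOn.div (by fun_prop) (by fun_prop) fun x hx => ?_
    have : 0 < x := by linarith [hx.1]
    linarith [add_one_lt_exp this.ne']
  have h1 : (fun x : ℝ => x * exp x / (exp x - 1)) (c - 1) ≤ c := by
    have := add_one_lt_exp (x := c - 1) (by linarith)
    simp only
    rw [div_le_iff₀ (by linarith)]
    nlinarith
  have h2 : c ≤ (fun x : ℝ => x * exp x / (exp x - 1)) c := by
    have := add_one_lt_exp (x := c) (by linarith)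
    simp only
    rw [le_div_iff₀ (by linarith)]
    nlinarith
  obtain ⟨x, hx, hxc⟩ := intermediate_value_Icc (by linarith) hcont ⟨h1, h2⟩
  have hp : IsParam c x := ⟨by linarith [hx.1], hxc.symm⟩
  exact ⟨x, hp, fun y hy => isParam_unique hy hp⟩

theorem IsParam.lt {c lam : ℝ} (h : IsParam c lam) : lam < c := by
  obtain ⟨h0, h⟩ := isParam_iff.1 h
  have := add_one_lt_exp h0.ne'
  nlinarith

theorem IsParam.le_one_add {c lam : ℝ} (h : IsParam c lam) : c ≤ 1 + lam := by
  obtain ⟨h0, h⟩ := isParam_iff.1 h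
  have := add_one_lt_exp h0.ne'
  nlinarith

theorem IsParam.one_lt {c lam : ℝ} (h : IsParam c lam) : 1 < c := by
  obtain ⟨h0, h⟩ := isParam_iff.1 h
  have h1 := add_one_lt_exp h0.ne'
  have h2 := add_one_lt_exp (x := -lam) (by linarith)
  have h3 : exp lam * exp (-lam) = 1 := by rw [← exp_add]; simp
  have h4 : 0 < exp lam := exp_pos _
  nlinarith

/-- The variance `c * (1 + lam - c)` of the zero-truncated Poisson distribution with mean `c` lies
between `lam / 2` and `lam`. -/
theorem IsParam.variance_le {c lam : ℝ} (h : IsParam c lam) : c * (1 + lam - c) ≤ lam := by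
  nlinarith [h.one_lt, h.lt]

theorem IsParam.le_variance {c lam : ℝ} (h : IsParam c lam) : lam / 2 ≤ c * (1 + lam - c) := by
  have hlt := h.lt
  obtain ⟨h0, h⟩ := isParam_iff.1 h
  have h1 := quadratic_le_exp_of_nonneg h0.le
  -- Here `c - lam = lam / (e^lam - 1)`; the quadratic lower bound for `exp` keeps it far enough
  -- below 1.
  have hu : (c - lam) * (1 + lam / 2) ≤ 1 := by
    have : (c - lam) * (exp lam - 1) = lam := by linarith
    have : (c - lam) * (lam + lam ^ 2 / 2) ≤ lam := by
      nlinarith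
    nlinarith
  set u := c - lam with hu'
  have hc : c = u + lam := by linarith
  rw [hc]
  have hu0 : 0 < u := by linarith
  have : (u + lam) * (1 + lam - (u + lam)) = (u + lam) * (1 - u) := by ring
  rw [this]
  nlinarith [mul_nonneg hu0.le (sub_nonneg.2 hu), mul_pos hu0 h0]

end Dicore

/-! ### The double Cauchy integral. -/

namespace Dicore

open MeasureTheory Complex Finset
open scoped Real

theorem hasSum_of_eq {E : Type*} [AddCommMonoid E] [TopologicalSpace E] {f g : ℕ → E} {a b : E}
    (h : HasSum f a) (hfg : ∀ k, g k = f k) (hab : b = a) : HasSum g b := by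
  rwa [hab, show g = f from funext hfg]

theorem integral_exp_int_mul_I (k : ℤ) :
    ∫ φ in (-π)..π, exp (k * φ * I) = if k = 0 then (2 * π : ℂ) else 0 := by
  split_ifs with hk
  · subst hk
    simp
    ring
  · have hk' : (k : ℂ) * I ≠ 0 := by simp [hk]
    have h : ∀ φ : ℝ, exp (k * φ * I) = exp (k * I * φ) := fun φ => by ring_nf
    simp_rw [h]
    rw [integral_exp_mul_complex hk', div_eq_zero_iff]
    left
    rw [sub_eq_zero, exp_eq_exp_iff_exists_int]
    exact ⟨k, by push_cast; ring⟩

/-- Integrate the power series of the exponential term by term; orthogonality leaves only the term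
of index `k`. -/
theorem integral_exp_mul_exp (a : ℂ) (k : ℕ) :
    ∫ φ in (-π)..π, exp (a * exp (φ * I)) * exp (-(k * φ * I)) =
      2 * π * (a ^ k / k.factorial) := by
  have h := intervalIntegral.hasSum_integral_of_dominated_convergence (μ := volume) (a := -π) (b := π)
    (F := fun (j : ℕ) (φ : ℝ) => (a ^ j / j.factorial) * exp (((j - k : ℤ) : ℂ) * φ * I))
    (f := fun φ : ℝ => exp (a * exp (φ * I)) * exp (-(k * φ * I)))
    (fun j _ => ‖a‖ ^ j / j.factorial)
    (fun j => (by fun_prop : Continuous _).aestronglyMeasurable)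
    (fun j => ae_of_all _ fun φ _ => by
      have : ((j - k : ℤ) : ℂ) * φ * I = (((j - k : ℤ) : ℝ) * φ : ℝ) * I := by push_cast; ring
      rw [norm_mul, this, norm_exp_ofReal_mul_I]
      simp)
    (ae_of_all _ fun φ _ => Real.summable_pow_div_factorial ‖a‖)
    (by simp)
    (ae_of_all _ fun φ _ => by
      have h := (NormedSpace.expSeries_div_hasSum_exp (a * exp (φ * I))).mul_right
        (exp (-(k * φ * I)))
      rw [← exp_eq_exp_ℂ] at h
      refine hasSum_of_eq h (fun j => ?_) rfl
      rw [mul_pow, ← exp_nat_mul, mul_div_right_comm, mul_assoc (a ^ j / _), ← exp_add]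
      congr 2
      push_cast
      ring)
  simp_rw [intervalIntegral.integral_const_mul, integral_exp_int_mul_I] at h
  have h2 := hasSum_ite_eq k (2 * π * (a ^ k / k.factorial))
  refine h.unique ?_
  refine hasSum_of_eq h2 (fun j => ?_) rfl
  by_cases hj : j = k
  · subst hj; simp; ring
  · have : (j : ℤ) - k ≠ 0 := by omega
    simp [hj, this]

theorem norm_sinh_le (z : ℂ) : ‖sinh z‖ ≤ Real.sinh ‖z‖ := by
  refine (hasSum_sinh z).norm_le_of_bounded (Real.hasSum_sinh ‖z‖) fun n => ?_
  simp

/-- The characteristic function of the zero-truncated Poisson distribution. -/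
noncomputable def chi (lam φ : ℝ) : ℂ := (exp (lam * exp (φ * I)) - 1) / (exp lam - 1)

@[fun_prop]
theorem continuous_chi (lam : ℝ) : Continuous (chi lam) := by
  unfold chi
  fun_prop

/-- Write `e^w - 1 = 2 e^(w/2) sinh (w/2)`. On the circle the modulus of the `sinh` factor is
largest on the real axis, its power series having nonnegative coefficients. The decay comes from
`e^(w/2)` and `cos φ ≤ 1 - 2 φ^2 / π^2`. Unlike a bound through `e^w` alone, this survives small
`lam`. -/
theorem norm_chi_le {lam φ : ℝ} (hlam : 0 < lam) (hφ : |φ| ≤ π) :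
    ‖chi lam φ‖ ≤ Real.exp (-(lam * φ ^ 2 / π ^ 2)) := by
  have h1 : ∀ w : ℂ, exp w - 1 = 2 * exp (w / 2) * sinh (w / 2) := by
    intro w
    have e1 : exp w = exp (w / 2) * exp (w / 2) := by rw [← exp_add]; ring_nf
    have e2 : exp (w / 2) * exp (-(w / 2)) = 1 := by rw [← exp_add]; simp
    rw [sinh, e1]
    linear_combination e2
  have hs : 0 < Real.sinh (lam / 2) := Real.sinh_pos_iff.2 (by linarith)
  have hnw : ‖(lam : ℂ) * exp (φ * I) / 2‖ = lam / 2 := by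
    rw [norm_div, norm_mul, norm_exp_ofReal_mul_I]
    simp [abs_of_pos hlam]
  rw [chi, h1, h1, norm_div, norm_mul, norm_mul, norm_mul, norm_mul, norm_exp, norm_exp]
  have hre : ((lam : ℂ) * exp (φ * I) / 2).re = lam * Real.cos φ / 2 := by
    rw [exp_mul_I, ← ofReal_cos, ← ofReal_sin]
    simp [-ofReal_cos, -ofReal_sin]
  have hre' : ((lam : ℂ) / 2).re = lam / 2 := by simp
  have hsn : ‖sinh ((lam : ℂ) / 2)‖ = Real.sinh (lam / 2) := by
    have : (lam : ℂ) / 2 = ((lam / 2 : ℝ) : ℂ) := by push_cast; rfl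
    rw [this, ← ofReal_sinh, norm_real, Real.norm_of_nonneg hs.le]
  rw [hre, hre', hsn, div_le_iff₀ (mul_pos (mul_pos (by simp) (Real.exp_pos _)) hs)]
  have hcos := Real.cos_le_one_sub_mul_cos_sq hφ
  have hn := norm_sinh_le ((lam : ℂ) * exp (φ * I) / 2)
  rw [hnw] at hn
  have he : Real.exp (lam * Real.cos φ / 2) ≤
      Real.exp (-(lam * φ ^ 2 / π ^ 2)) * Real.exp (lam / 2) := by
    rw [← Real.exp_add]
    apply Real.exp_le_exp.2
    have : lam * Real.cos φ ≤ lam * (1 - 2 / π ^ 2 * φ ^ 2) := by gcongr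
    have e : lam * (1 - 2 / π ^ 2 * φ ^ 2) = lam - 2 * (lam * φ ^ 2 / π ^ 2) := by ring
    linarith
  calc _ ≤ ‖(2 : ℂ)‖ * (Real.exp (-(lam * φ ^ 2 / π ^ 2)) * Real.exp (lam / 2)) *
        Real.sinh (lam / 2) := by gcongr
    _ = _ := by ring

/-- By the binomial theorem `altSum n k / k!` is the `k`-th Taylor coefficient of `(e^x - 1)^n`,
extracted here on the circle of radius `lam`. -/
theorem altSum_eq_integral (lam : ℝ) (n k : ℕ) :
    altSum n k * (lam : ℂ) ^ k * (2 * π) = k.factorial *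
      ∫ φ in Set.Ioc (-π) π, (exp (lam * exp (φ * I)) - 1) ^ n * exp (-(k * φ * I)) := by
  rw [← intervalIntegral.integral_of_le (by linarith [Real.pi_pos])]
  have h : ∀ φ : ℝ, (exp (lam * exp (φ * I)) - 1) ^ n * exp (-(k * φ * I)) =
      ∑ i ∈ range (n + 1), (-1) ^ (n - i) * (n.choose i : ℂ) *
        (exp ((i * lam : ℂ) * exp (φ * I)) * exp (-(k * φ * I))) := by
    intro φ
    rw [sub_eq_add_neg, add_pow, sum_mul]
    refine sum_congr rfl fun i _ => ?_
    rw [← exp_nat_mul, mul_assoc (i : ℂ)]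
    ring
  simp_rw [h]
  rw [intervalIntegral.integral_finsetSum fun i _ =>
    (by fun_prop : Continuous _).intervalIntegrable _ _]
  simp_rw [intervalIntegral.integral_const_mul, integral_exp_mul_exp]
  rw [altSum, sum_mul, sum_mul, mul_sum]
  refine sum_congr rfl fun i _ => ?_
  have : (k.factorial : ℂ) ≠ 0 := by exact_mod_cast k.factorial_ne_zero
  rw [mul_pow]
  field_simp

/-- The polynomial whose value near `lam ^ 2` approximates the probability that no arc is
repeated. -/
noncomputable def simpleFactor (m : ℕ) (z : ℂ) : ℂ :=
  ∑ j ∈ range (m + 1), fallCoeff m j * ((m - j).factorial / m.factorial) ^ 2 * z ^ j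

/-- Lebesgue measure on `(-π, π]`. -/
noncomputable def circleMeasure : Measure ℝ := volume.restrict (Set.Ioc (-π) π)

instance : IsFiniteMeasure circleMeasure := by
  unfold circleMeasure; infer_instance

theorem integrable_circleMeasure {f : ℝ → ℂ} (hf : Continuous f) : Integrable f circleMeasure :=
  (hf.integrableOn_Icc).mono_set Set.Ioc_subset_Icc_self

/-- Using the same radius for every power `m - j` lets the shift by `j` be absorbed as `z^j` with `z
= lam^2 e^(i(φ+ψ))`, so the whole sum collects into `simpleFactor`. -/
theorem ncard_dicores_eq_integral {lam : ℝ} (hlam : 0 < lam) (n m : ℕ) :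
    ((dicores n m).ncard : ℂ) * (lam ^ (2 * m) / (m.factorial * (exp lam - 1) ^ (2 * n))) *
      (2 * π) ^ 2 =
    ∫ p, chi lam p.1 ^ n * chi lam p.2 ^ n * exp (-(m * (p.1 + p.2) * I)) *
      simpleFactor m (lam ^ 2 * exp ((p.1 + p.2) * I)) ∂(circleMeasure.prod circleMeasure) := by
  have hE : exp lam - 1 ≠ 0 := by
    have := Real.add_one_lt_exp hlam.ne'
    have h2 : Real.exp lam - 1 ≠ 0 := by linarith
    exact_mod_cast h2
  have hl : (lam : ℂ) ≠ 0 := by exact_mod_cast hlam.ne'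
  have hm : (m.factorial : ℂ) ≠ 0 := by exact_mod_cast m.factorial_ne_zero
  let f : ℕ → ℝ → ℂ := fun k φ => chi lam φ ^ n * exp (-(k * φ * I))
  have hf : ∀ k, Integrable (f k) circleMeasure := fun k =>
    integrable_circleMeasure (by fun_prop)
  have hint : ∀ k, (∫ φ, f k φ ∂circleMeasure) * (exp lam - 1) ^ n * k.factorial =
      altSum n k * (lam : ℂ) ^ k * (2 * π) := by
    intro k
    rw [altSum_eq_integral lam, ← integral_mul_const, ← integral_mul_const, circleMeasure,
      ← integral_const_mul]
    congr 1 with φ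
    simp only [f, chi, div_pow]
    field_simp
  have hexp : ∀ p : ℝ × ℝ, chi lam p.1 ^ n * chi lam p.2 ^ n * exp (-(m * (p.1 + p.2) * I)) *
      simpleFactor m (lam ^ 2 * exp ((p.1 + p.2) * I)) =
      ∑ j ∈ range (m + 1), fallCoeff m j * ((m - j).factorial / m.factorial) ^ 2 *
        (lam ^ 2) ^ j * (f (m - j) p.1 * f (m - j) p.2) := by
    intro p
    rw [simpleFactor, mul_sum]
    refine sum_congr rfl fun j hj => ?_
    have hj' : j ≤ m := by simpa [Nat.lt_succ_iff] using hj
    have e : exp (-(m * (p.1 + p.2) * I)) * exp ((p.1 + p.2) * I) ^ j =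
        exp (-((m - j : ℕ) * p.1 * I)) * exp (-((m - j : ℕ) * p.2 * I)) := by
      rw [← exp_nat_mul, ← exp_add, ← exp_add]
      congr 1
      push_cast [Nat.cast_sub hj']
      ring
    simp only [f]
    rw [mul_pow]
    linear_combination (chi lam p.1 ^ n * chi lam p.2 ^ n * fallCoeff m j *
      ((m - j).factorial / m.factorial) ^ 2 * (lam ^ 2) ^ j) * e
  simp_rw [hexp]
  rw [integral_finsetSum _ fun j _ => ((hf _).mul_prod (hf _)).const_mul _]
  simp_rw [integral_const_mul, integral_prod_mul]
  have hN := factorial_mul_ncard_dicores n m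
  have : ((dicores n m).ncard : ℂ) =
    (∑ j ∈ range (m + 1), fallCoeff m j * altSum n (m - j) ^ 2) / m.factorial := by
    rw [← hN]; field_simp
  rw [this, sum_div, sum_mul, sum_mul]
  refine sum_congr rfl fun j hj => ?_
  have hj' : j ≤ m := by simpa [Nat.lt_succ_iff] using hj
  have hk := hint (m - j)
  have hk2 : ((∫ φ, f (m - j) φ ∂circleMeasure) * (exp lam - 1) ^ n * (m - j).factorial) ^ 2 =
      (altSum n (m - j) * (lam : ℂ) ^ (m - j) * (2 * π)) ^ 2 := by rw [hk]
  have hp : (lam : ℂ) ^ (2 * m) = (lam ^ (m - j)) ^ 2 * (lam ^ 2) ^ j := by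
    rw [← pow_mul, ← pow_mul, ← pow_add]; congr 1; omega
  rw [hp]
  field_simp
  linear_combination (- fallCoeff m j) * hk2

end Dicore

/-! ### Averaging a polynomial over a concentrated Gamma variable. -/

namespace Dicore

open MeasureTheory Finset

theorem exp_sub_sq_le_one_add {u : ℝ} (hu : |u| ≤ 1 / 2) : Real.exp (u - u ^ 2) ≤ 1 + u := by
  rw [abs_le] at hu
  have h2 : (1 + u) * Real.exp (-(u - u ^ 2)) ≥ 1 := by
    rcases le_total 0 u with h | h
    · have := Real.add_one_le_exp (-(u - u ^ 2))
      nlinarith [mul_nonneg h h, mul_nonneg (mul_nonneg h h) h]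
    · have := Real.quadratic_le_exp_of_nonneg (x := -(u - u ^ 2)) (by nlinarith)
      have h3 : (1 + u) * (1 + -(u - u ^ 2) + (-(u - u ^ 2)) ^ 2 / 2) ≥ 1 := by
        obtain ⟨v, rfl⟩ : ∃ v, u = -v := ⟨-u, by ring⟩
        have hv : 0 ≤ v := by linarith
        have hv2 : v ≤ 1 / 2 := by linarith
        have e : (1 + -v) * (1 + -(-v - (-v) ^ 2) + (-(-v - (-v) ^ 2)) ^ 2 / 2) =
            1 + v ^ 2 * ((1 - v) * (1 + v) ^ 2 / 2 - v) := by ring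
        rw [e]
        have : 0 ≤ (1 - v) * (1 + v) ^ 2 / 2 - v := by
          nlinarith [mul_nonneg hv hv, mul_nonneg hv (sub_nonneg.2 hv2),
            mul_nonneg (mul_nonneg hv hv) (sub_nonneg.2 hv2)]
        nlinarith [mul_nonneg (sq_nonneg v) this]
      have h4 : 0 ≤ 1 + u := by linarith
      nlinarith [mul_le_mul_of_nonneg_left this h4]
  rw [Real.exp_neg] at h2
  have hp := Real.exp_pos (u - u ^ 2)
  rw [ge_iff_le, ← div_eq_mul_inv, le_div_iff₀ hp, one_mul] at h2
  exact h2

theorem integral_pow_mul_exp (k : ℕ) {r : ℝ} (hr : 0 < r) :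
    ∫ s in Set.Ioi (0 : ℝ), s ^ k * Real.exp (-(r * s)) = k.factorial / r ^ (k + 1) := by
  have h := Real.integral_rpow_mul_exp_neg_mul_Ioi (a := k + 1) (by positivity) hr
  rw [Real.Gamma_nat_eq_factorial] at h
  simp only [add_sub_cancel_right, Real.rpow_natCast] at h
  rw [h]
  rw [← Nat.cast_succ, Real.rpow_natCast, one_div, inv_pow]
  field_simp

theorem integrable_pow_mul_exp (k : ℕ) {r : ℝ} (hr : 0 < r) :
    Integrable (fun s : ℝ => s ^ k * Real.exp (-(r * s))) (volume.restrict (Set.Ioi 0)) := by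
  by_contra h
  have h2 := integral_pow_mul_exp k hr
  rw [integral_undef h] at h2
  have : 0 < (k.factorial : ℝ) / r ^ (k + 1) := by positivity
  linarith

theorem integrable_sum_pow_smul {E : Type*} [NormedAddCommGroup E] [NormedSpace ℝ E] (m : ℕ)
    (c : ℕ → E) {r : ℝ} (hr : 0 < r) :
    Integrable (fun s : ℝ => ∑ j ∈ range (m + 1), (s ^ (m - j) * Real.exp (-(r * s))) • c j)
      (volume.restrict (Set.Ioi 0)) :=
  integrable_finsetSum _ fun _ _ => (integrable_pow_mul_exp _ hr).smul_const _

theorem integral_sum_pow_smul {E : Type*} [NormedAddCommGroup E] [NormedSpace ℝ E]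
    [CompleteSpace E] (m : ℕ) (c : ℕ → E) {r : ℝ} (hr : 0 < r) :
    ∫ s in Set.Ioi (0 : ℝ), ∑ j ∈ range (m + 1), (s ^ (m - j) * Real.exp (-(r * s))) • c j =
      ∑ j ∈ range (m + 1), ((m - j).factorial / r ^ (m - j + 1) : ℝ) • c j := by
  rw [integral_finsetSum _ fun _ _ => (integrable_pow_mul_exp _ hr).smul_const _]
  simp_rw [integral_smul_const, integral_pow_mul_exp _ hr]

/-- The normalized moments `E[(m / s) ^ j]` of a random variable `s` with density
`s ^ m * exp (-s) / m!`. -/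
noncomputable def gammaWeight (m j : ℕ) : ℝ := m ^ j * (m - j).factorial / m.factorial

theorem gammaWeight_zero (m : ℕ) : gammaWeight m 0 = 1 := by
  have : (m.factorial : ℝ) ≠ 0 := by exact_mod_cast m.factorial_ne_zero
  simp [gammaWeight, this]

theorem gammaWeight_nonneg (m j : ℕ) : 0 ≤ gammaWeight m j := by
  unfold gammaWeight; positivity

/-- Comparing factors, `m / (m - i) ≤ j / (j - i)`, so the weight is at most `j^j / j! ≤ e^j`. -/
theorem gammaWeight_le {m j : ℕ} (hj : j ≤ m) : gammaWeight m j ≤ 3 ^ j := by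
  have h1 : m ^ j * j.factorial ≤ j ^ j * m.descFactorial j := by
    rw [← Nat.descFactorial_self, Nat.descFactorial_eq_prod_range, Nat.descFactorial_eq_prod_range,
      ← card_range j, ← prod_const, ← prod_const, card_range, ← prod_mul_distrib,
      ← prod_mul_distrib]
    refine prod_le_prod' fun i hi => ?_
    have hi' : i < j := mem_range.1 hi
    zify [hi'.le, hi'.le.trans hj]
    nlinarith
  have h2 := Nat.factorial_mul_descFactorial hj
  have h3 : (j : ℝ) ^ j ≤ 3 ^ j * j.factorial := by
    have := Real.pow_div_factorial_le_exp (j : ℝ) (by positivity) j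
    rw [div_le_iff₀ (by positivity)] at this
    refine this.trans ?_
    gcongr
    rw [← mul_one (j : ℝ), Real.exp_nat_mul]
    gcongr
    linarith [Real.exp_one_lt_d9]
  have h1' : (m : ℝ) ^ j * j.factorial ≤ j ^ j * m.descFactorial j := by exact_mod_cast h1
  have h4 : (m : ℝ) ^ j ≤ 3 ^ j * m.descFactorial j := by
    have hp : (0 : ℝ) < j.factorial := by positivity
    have : (m : ℝ) ^ j * j.factorial ≤ (3 ^ j * m.descFactorial j) * j.factorial := by
      calc _ ≤ _ := h1'
        _ ≤ (3 ^ j * j.factorial) * m.descFactorial j := by gcongr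
        _ = _ := by ring
    exact le_of_mul_le_mul_right this hp
  rw [gammaWeight, div_le_iff₀ (by positivity), ← h2]
  push_cast
  calc _ ≤ 3 ^ j * (m.descFactorial j : ℝ) * ((m - j).factorial) := by gcongr
    _ = _ := by ring

/-- A tail of the Gamma average, after tilting by an exponential. -/
theorem gamma_tail_le {b : ℕ → ℂ} {m : ℕ} {A κ x r : ℝ}
    (hb : ∀ x : ℝ, 0 ≤ x → ∑ j ∈ range (m + 1), ‖b j‖ * x ^ j ≤ A * Real.exp (κ * x))
    (hx : 0 ≤ x) (hr : 0 < r) {K : ℝ} (hK : 0 ≤ K) :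
    ∑ j ∈ range (m + 1), ((m - j).factorial / r ^ (m - j + 1) : ℝ) • (K * (‖b j‖ * (x * m) ^ j)) ≤
      m.factorial * (K * (r ^ (m + 1))⁻¹ * (A * Real.exp (κ * (3 * x * r)))) := by
  have h := hb (3 * x * r) (by positivity)
  calc _ = ∑ j ∈ range (m + 1), (m.factorial * (K * (r ^ (m + 1))⁻¹)) *
        (‖b j‖ * (gammaWeight m j * (x * r) ^ j)) := by
        refine sum_congr rfl fun j hj => ?_
        have hj' : j ≤ m := by simpa [Nat.lt_succ_iff] using hj
        have e : r ^ (m + 1) = r ^ (m - j + 1) * r ^ j := by rw [← pow_add]; congr 1; omega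
        have : (m.factorial : ℝ) ≠ 0 := by exact_mod_cast m.factorial_ne_zero
        rw [gammaWeight, smul_eq_mul, e, mul_pow, mul_pow]
        field_simp
    _ ≤ ∑ j ∈ range (m + 1), (m.factorial * (K * (r ^ (m + 1))⁻¹)) *
        (‖b j‖ * (3 * x * r) ^ j) := by
        refine sum_le_sum fun j hj => ?_
        have hj' : j ≤ m := by simpa [Nat.lt_succ_iff] using hj
        rw [mul_assoc 3, mul_pow 3]
        have := gammaWeight_le hj'
        gcongr
    _ ≤ _ := by
        rw [← mul_sum]
        exact (mul_le_mul_of_nonneg_left h (by positivity)).trans_eq (by ring)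

/-- For `P z = ∑ b_j z^j` the weighted sum is the mean of `P (z m / s)` with `s` of density `s^m
e^(-s) / m!`. If `|s - m| ≤ δ m`, the argument stays in the larger disc where `P` is small; the rest
of the mass is exponentially small by Chernoff bounds, and the majorant `A e^(κx)` controls `P`
there. -/
theorem norm_gammaAverage_le {b : ℕ → ℂ} {m : ℕ} (hm : 0 < m) {A κ ρ α δ ε : ℝ} (hA : 0 ≤ A)
    (hκ : 0 ≤ κ) (hρ : 0 ≤ ρ) (hα1 : α ≤ 1) (hδ : 0 < δ) (hδ1 : δ ≤ 1 / 2)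
    (hb : ∀ x : ℝ, 0 ≤ x → ∑ j ∈ range (m + 1), ‖b j‖ * x ^ j ≤ A * Real.exp (κ * x))
    (hP : ∀ z : ℂ, ‖z - ρ‖ ≤ (α + 4 * δ) * ρ → ‖∑ j ∈ range (m + 1), b j * z ^ j‖ ≤ ε)
    {z : ℂ} (hz : ‖z - ρ‖ ≤ α * ρ) :
    ‖∑ j ∈ range (m + 1), b j * gammaWeight m j * z ^ j‖ ≤
      ε + 3 * A * Real.exp (12 * κ * ρ) * Real.exp (-(m * δ ^ 2 / 4)) := by
  have hm' : (0 : ℝ) < m := by exact_mod_cast hm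
  have hmf : (0 : ℝ) < m.factorial := by positivity
  have hzn : ‖z‖ ≤ 2 * ρ := by
    calc ‖z‖ = ‖(z - ρ) + ρ‖ := by simp
      _ ≤ ‖z - ρ‖ + ‖(ρ : ℂ)‖ := norm_add_le _ _
      _ ≤ α * ρ + ρ := by
        rw [Complex.norm_real, Real.norm_of_nonneg hρ]; gcongr
      _ ≤ 2 * ρ := by nlinarith
  -- This tilt minimises the exponent `m (u^2 - u δ)` and gives `-m δ^2 / 4` for both tails.
  set u := δ / 2 with hu
  have hu0 : 0 < u := by positivity
  let c : ℕ → ℂ := fun j => b j * (z * m) ^ j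
  let K₁ := Real.exp (u * ((1 - δ) * m))
  let K₂ := Real.exp (-(u * ((1 + δ) * m)))
  let d : ℕ → ℝ := fun j => ‖b j‖ * (‖z‖ * m) ^ j
  have hcd : ∀ j, ‖c j‖ = d j := fun j => by simp [c, d]
  have hI := integral_sum_pow_smul m c one_pos
  have hI' : ∑ j ∈ range (m + 1), ((m - j).factorial / (1 : ℝ) ^ (m - j + 1) : ℝ) • c j =
      m.factorial * ∑ j ∈ range (m + 1), b j * gammaWeight m j * z ^ j := by
    rw [mul_sum]
    refine sum_congr rfl fun j _ => ?_
    have : (m.factorial : ℂ) ≠ 0 := by exact_mod_cast m.factorial_ne_zero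
    simp only [c, gammaWeight, Complex.real_smul]
    push_cast
    rw [mul_pow]
    field_simp
    simp
  rw [hI'] at hI
  have hbound : ∀ s ∈ Set.Ioi (0 : ℝ),
      ‖∑ j ∈ range (m + 1), (s ^ (m - j) * Real.exp (-(1 * s))) • c j‖ ≤
      s ^ m * Real.exp (-(1 * s)) * ε +
        ((∑ j ∈ range (m + 1), (s ^ (m - j) * Real.exp (-((1 + u) * s))) • (K₁ * d j)) +
        ∑ j ∈ range (m + 1), (s ^ (m - j) * Real.exp (-((1 - u) * s))) • (K₂ * d j)) := by
    intro s hs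
    have hs : 0 < s := hs
    have hε : 0 ≤ ε := (norm_nonneg _).trans (hP ρ (by
      simp only [sub_self, norm_zero]
      have : 0 ≤ α * ρ := (norm_nonneg _).trans hz
      nlinarith [mul_nonneg hδ.le hρ]))
    have hd : ∀ j, 0 ≤ d j := fun j => by positivity
    have hn1 : 0 ≤ ∑ j ∈ range (m + 1), (s ^ (m - j) * Real.exp (-((1 + u) * s))) • (K₁ * d j) :=
      sum_nonneg fun j _ => by have := hd j; rw [smul_eq_mul]; positivity
    have hn2 : 0 ≤ ∑ j ∈ range (m + 1), (s ^ (m - j) * Real.exp (-((1 - u) * s))) • (K₂ * d j) :=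
      sum_nonneg fun j _ => by have := hd j; rw [smul_eq_mul]; positivity
    have hn3 : 0 ≤ s ^ m * Real.exp (-(1 * s)) * ε := by positivity
    have htail : ‖∑ j ∈ range (m + 1), (s ^ (m - j) * Real.exp (-(1 * s))) • c j‖ ≤
        ∑ j ∈ range (m + 1), s ^ (m - j) * Real.exp (-(1 * s)) * d j := by
      refine (norm_sum_le _ _).trans (sum_le_sum fun j _ => ?_)
      rw [norm_smul, hcd, Real.norm_of_nonneg (by positivity)]
    rcases lt_or_ge s ((1 - δ) * m) with h1 | h1
    · have : ∑ j ∈ range (m + 1), s ^ (m - j) * Real.exp (-(1 * s)) * d j ≤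
          ∑ j ∈ range (m + 1), (s ^ (m - j) * Real.exp (-((1 + u) * s))) • (K₁ * d j) := by
        refine sum_le_sum fun j _ => ?_
        have hE : Real.exp (-(1 * s)) ≤ Real.exp (-((1 + u) * s)) * K₁ := by
          rw [← Real.exp_add]
          apply Real.exp_le_exp.2
          nlinarith
        have := hd j
        calc _ ≤ s ^ (m - j) * (Real.exp (-((1 + u) * s)) * K₁) * d j := by gcongr
          _ = _ := by rw [smul_eq_mul]; ring
      linarith
    rcases lt_or_ge ((1 + δ) * m) s with h2 | h2
    · have : ∑ j ∈ range (m + 1), s ^ (m - j) * Real.exp (-(1 * s)) * d j ≤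
          ∑ j ∈ range (m + 1), (s ^ (m - j) * Real.exp (-((1 - u) * s))) • (K₂ * d j) := by
        refine sum_le_sum fun j _ => ?_
        have hE : Real.exp (-(1 * s)) ≤ Real.exp (-((1 - u) * s)) * K₂ := by
          rw [← Real.exp_add]
          apply Real.exp_le_exp.2
          nlinarith
        have := hd j
        calc _ ≤ s ^ (m - j) * (Real.exp (-((1 - u) * s)) * K₂) * d j := by gcongr
          _ = _ := by rw [smul_eq_mul]; ring
      linarith
    · have hsC : (s : ℂ) ≠ 0 := by exact_mod_cast hs.ne'
      have e : ∑ j ∈ range (m + 1), (s ^ (m - j) * Real.exp (-(1 * s))) • c j =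
          (s ^ m * Real.exp (-(1 * s)) : ℝ) • ∑ j ∈ range (m + 1), b j * (z * (m / s)) ^ j := by
        rw [smul_sum]
        refine sum_congr rfl fun j hj => ?_
        have hj' : j ≤ m := by simpa [Nat.lt_succ_iff] using hj
        simp only [c, Complex.real_smul]
        push_cast
        have : (s : ℂ) ^ m = s ^ (m - j) * s ^ j := by rw [← pow_add]; congr 1; omega
        rw [this, mul_pow, mul_pow, div_pow]
        field_simp
      -- The bound uses `s ≥ (1 - δ) m ≥ m / 2`. Together with `‖z‖ ≤ 2ρ` it explains the
      -- enlargement of the disc by `4δρ`.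
      have hq : |(m : ℝ) / s - 1| ≤ 2 * δ := by
        have : (m : ℝ) / s - 1 = (m - s) / s := by field_simp
        rw [this, abs_div, abs_of_pos hs, div_le_iff₀ hs, abs_le]
        constructor <;> nlinarith
      have hin : ‖z * (m / s) - ρ‖ ≤ (α + 4 * δ) * ρ := by
        have e2 : z * (m / s) - ρ = (z - ρ) + z * (((m : ℝ) / s - 1 : ℝ) : ℂ) := by
          push_cast; ring
        rw [e2]
        refine (norm_add_le _ _).trans ?_
        rw [norm_mul, Complex.norm_real, Real.norm_eq_abs]
        have : ‖z‖ * |(m : ℝ) / s - 1| ≤ (2 * ρ) * (2 * δ) := by gcongr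
        nlinarith
      rw [e, norm_smul, Real.norm_of_nonneg (by positivity)]
      have := hP _ hin
      have h3 : s ^ m * Real.exp (-(1 * s)) * ‖∑ j ∈ range (m + 1), b j * (z * (m / s)) ^ j‖ ≤
        s ^ m * Real.exp (-(1 * s)) * ε := by gcongr
      linarith
  have hu1 : 0 < 1 - u := by linarith
  have i1 := (integrable_pow_mul_exp m one_pos).mul_const ε
  have i2 := integrable_sum_pow_smul m (fun j => K₁ * d j) (r := 1 + u) (by positivity)
  have i3 := integrable_sum_pow_smul m (fun j => K₂ * d j) (r := 1 - u) hu1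
  have hle := norm_integral_le_of_norm_le (i1.add (i2.add i3))
    ((ae_restrict_iff' measurableSet_Ioi).2 (ae_of_all _ hbound))
  rw [hI, norm_mul, Complex.norm_natCast] at hle
  have hsplit := integral_add i1 (i2.add i3)
  have hsplit2 := integral_add i2 i3
  simp only [Pi.add_apply] at hle hsplit hsplit2
  rw [hsplit, hsplit2, integral_mul_const, integral_pow_mul_exp m one_pos,
    integral_sum_pow_smul m _ (by positivity), integral_sum_pow_smul m _ hu1] at hle
  have t1 := gamma_tail_le hb (norm_nonneg z) (r := 1 + u) (by positivity) (K := K₁) (by positivity)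
  have t2 := gamma_tail_le hb (norm_nonneg z) hu1 (K := K₂) (by positivity)
  set X := Real.exp (12 * κ * ρ)
  set Y := Real.exp (-(m * δ ^ 2 / 4))
  have hexp : ∀ r : ℝ, 0 < r → r ≤ 2 → Real.exp (κ * (3 * ‖z‖ * r)) ≤ X := by
    intro r h0 h2
    apply Real.exp_le_exp.2
    have : ‖z‖ * r ≤ (2 * ρ) * 2 := by gcongr
    nlinarith [mul_le_mul_of_nonneg_left this hκ]
  have hpow : ∀ v : ℝ, |v| ≤ 1 / 2 → Real.exp (m * (v - v ^ 2)) ≤ (1 + v) ^ m := by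
    intro v hv
    rw [Real.exp_nat_mul]
    have := exp_sub_sq_le_one_add hv
    gcongr
  have b1 : K₁ * ((1 + u) ^ (m + 1))⁻¹ ≤ Y := by
    have hp := hpow u (by rw [abs_of_pos hu0]; linarith)
    rw [← div_eq_mul_inv, div_le_iff₀ (by positivity), pow_succ]
    calc K₁ = Y * Real.exp (m * (u - u ^ 2)) := by
          rw [← Real.exp_add]; simp only [K₁, hu]; congr 1; ring
      _ ≤ Y * ((1 + u) ^ m * (1 + u)) := by
          gcongr
          refine hp.trans (le_mul_of_one_le_right (by positivity) (by linarith))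
  have b2 : K₂ * ((1 - u) ^ (m + 1))⁻¹ ≤ 2 * Y := by
    have hp := hpow (-u) (by rw [abs_neg, abs_of_pos hu0]; linarith)
    rw [← sub_eq_add_neg] at hp
    rw [← div_eq_mul_inv, div_le_iff₀ (by positivity), pow_succ]
    calc K₂ = Y * Real.exp (m * (-u - (-u) ^ 2)) := by
          rw [← Real.exp_add]; simp only [K₂, hu]; congr 1; ring
      _ ≤ Y * ((1 - u) ^ m * (2 * (1 - u))) := by
          gcongr
          refine hp.trans (le_mul_of_one_le_right (by positivity) (by linarith))
      _ = _ := by ring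
  have f1 : K₁ * ((1 + u) ^ (m + 1))⁻¹ * (A * Real.exp (κ * (3 * ‖z‖ * (1 + u)))) ≤ Y * (A * X) := by
    have := hexp (1 + u) (by positivity) (by linarith)
    gcongr
  have f2 : K₂ * ((1 - u) ^ (m + 1))⁻¹ * (A * Real.exp (κ * (3 * ‖z‖ * (1 - u)))) ≤
      2 * Y * (A * X) := by
    have := hexp (1 - u) hu1 (by linarith)
    gcongr
  have g1 := mul_le_mul_of_nonneg_left f1 hmf.le
  have g2 := mul_le_mul_of_nonneg_left f2 hmf.le
  refine le_of_mul_le_mul_left ?_ hmf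
  rw [one_pow, div_one] at hle
  calc _ ≤ _ := hle
    _ ≤ m.factorial * ε + (m.factorial * (Y * (A * X)) + m.factorial * (2 * Y * (A * X))) := by
      gcongr
      · exact t1.trans g1
      · exact t2.trans g2
    _ = _ := by ring

end Dicore

/-! ### Estimates for `simpleFactor`. -/

namespace Dicore

open MeasureTheory Finset

theorem sum_range_cast_le (m : ℕ) : ∑ i ∈ range m, (i : ℝ) ≤ m ^ 2 / 2 := by
  have h := Finset.sum_range_id_mul_two m
  have h' : (∑ i ∈ range m, (i : ℝ)) * 2 = m * ((m - 1 : ℕ) : ℝ) := by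
    rw [← Nat.cast_mul, ← h]
    push_cast
    rfl
  have : ((m - 1 : ℕ) : ℝ) ≤ m := by exact_mod_cast Nat.sub_le m 1
  nlinarith [(Nat.cast_nonneg m : (0 : ℝ) ≤ m)]

/-- All terms of `fallCoeff m j` have the same sign, so taking norms turns the product into `∏ (1 +
i x)`. -/
theorem sum_norm_fallCoeff_le (m : ℕ) {x : ℝ} (hx : 0 ≤ x) :
    ∑ j ∈ range (m + 1), ‖fallCoeff m j‖ * x ^ j ≤ Real.exp (m ^ 2 * x / 2) := by
  calc _ ≤ ∑ j ∈ range (m + 1), ∑ t ∈ powersetCard j (range m), ∏ i ∈ t, (i * x : ℝ) := by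
        refine sum_le_sum fun j _ => ?_
        rw [fallCoeff]
        refine (mul_le_mul_of_nonneg_right (norm_sum_le _ _) (by positivity)).trans ?_
        rw [sum_mul]
        refine sum_le_sum fun t ht => ?_
        rw [prod_mul_distrib, prod_const, (mem_powersetCard.1 ht).2, norm_prod]
        simp
    _ = ∏ i ∈ range m, (1 + i * x : ℝ) := by
        rw [prod_one_add, sum_powerset, card_range]
    _ ≤ Real.exp (∑ i ∈ range m, (i * x : ℝ)) := by
        rw [Real.exp_sum]
        refine prod_le_prod (fun i _ => by positivity) fun i _ => ?_
        rw [add_comm]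
        exact Real.add_one_le_exp _
    _ ≤ _ := by
        apply Real.exp_le_exp.2
        rw [← sum_mul]
        have := mul_le_mul_of_nonneg_right (sum_range_cast_le m) hx
        linarith

theorem sum_norm_fallCoeff_div_le {m : ℕ} (hm : 0 < m) {x : ℝ} (hx : 0 ≤ x) :
    ∑ j ∈ range (m + 1), ‖fallCoeff m j / (m : ℂ) ^ (2 * j)‖ * x ^ j ≤ Real.exp (1 / 2 * x) := by
  have hm' : (0 : ℝ) < m := by exact_mod_cast hm
  have h := sum_norm_fallCoeff_le m (x := x / m ^ 2) (by positivity)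
  have e : (m : ℝ) ^ 2 * (x / m ^ 2) / 2 = 1 / 2 * x := by field_simp
  rw [e] at h
  refine le_trans (le_of_eq (sum_congr rfl fun j _ => ?_)) h
  rw [norm_div, norm_pow, Complex.norm_natCast, div_pow, ← pow_mul]
  ring

theorem simpleFactor_eq {m : ℕ} (hm : 0 < m) (z : ℂ) : simpleFactor m z =
    ∑ j ∈ range (m + 1), fallCoeff m j / (m : ℂ) ^ (2 * j) * gammaWeight m j * gammaWeight m j *
      z ^ j := by
  have hm' : (m : ℂ) ≠ 0 := by exact_mod_cast hm.ne'
  refine sum_congr rfl fun j _ => ?_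
  rw [gammaWeight, mul_comm 2 j, pow_mul]
  push_cast
  field_simp

/-- A crude bound for every `z`, meant for the region far from the saddle: two weights cost `9^j`,
and `9 / 2 ≤ 5`. -/
theorem norm_simpleFactor_le {m : ℕ} (hm : 0 < m) (z : ℂ) :
    ‖simpleFactor m z‖ ≤ Real.exp (5 * ‖z‖) := by
  rw [simpleFactor_eq hm]
  refine (norm_sum_le _ _).trans ?_
  have h := sum_norm_fallCoeff_div_le hm (x := 9 * ‖z‖) (by positivity)
  refine (sum_le_sum fun j hj => ?_).trans (h.trans ?_)
  · have hj' : j ≤ m := by simpa [Nat.lt_succ_iff] using hj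
    have hg := gammaWeight_le hj'
    have hg0 := gammaWeight_nonneg m j
    rw [norm_mul, norm_mul, norm_mul, norm_pow, Complex.norm_real, Real.norm_of_nonneg hg0, mul_pow,
      mul_assoc, mul_assoc]
    have : gammaWeight m j * (gammaWeight m j * ‖z‖ ^ j) ≤ 3 ^ j * (3 ^ j * ‖z‖ ^ j) := by gcongr
    have e : (3 : ℝ) ^ j * (3 ^ j * ‖z‖ ^ j) = 9 ^ j * ‖z‖ ^ j := by
      rw [← mul_assoc, ← mul_pow]; norm_num
    rw [e] at this
    gcongr
  · apply Real.exp_le_exp.2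
    linarith [norm_nonneg z]

/-- The logarithm of the product is `-z/2 + z/(2m)` up to an error `‖z‖^2 / m`; `D` collects its
distance from `-ρ/2`. -/
theorem norm_prod_mul_exp_sub_one_le {m : ℕ} (hm : 0 < m) {z : ℂ} {ρ D : ℝ}
    (hz : ‖z‖ / m ≤ 1 / 2) (hD : ‖z - ρ‖ / 2 + ‖z‖ / (2 * m) + ‖z‖ ^ 2 / m ≤ D) (hD1 : D ≤ 1) :
    ‖(∏ i ∈ range m, (1 - i * (z / m ^ 2))) - ((Real.exp (-(ρ / 2)) : ℝ) : ℂ)‖ ≤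
      2 * D * Real.exp (-(ρ / 2)) := by
  have hm' : (0 : ℝ) < m := by exact_mod_cast hm
  have hmC : (m : ℂ) ≠ 0 := by exact_mod_cast hm.ne'
  let w : ℕ → ℂ := fun i => -(i * (z / m ^ 2))
  have hw : ∀ i ∈ range m, ‖w i‖ ≤ ‖z‖ / m := by
    intro i hi
    have hi' : (i : ℝ) ≤ m := by exact_mod_cast (mem_range.1 hi).le
    simp only [w, norm_neg, norm_mul, norm_div, norm_pow, Complex.norm_natCast]
    calc _ ≤ (m : ℝ) * (‖z‖ / m ^ 2) := by gcongr
      _ = _ := by field_simp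
  have hlog : ∀ i ∈ range m, ‖Complex.log (1 + w i) - w i‖ ≤ (‖z‖ / m) ^ 2 := by
    intro i hi
    have h1 := hw i hi
    have h2 := Complex.norm_log_one_add_sub_self_le (z := w i) (by linarith)
    refine h2.trans ?_
    have h3 : (1 - ‖w i‖)⁻¹ ≤ 2 := by
      rw [inv_le_comm₀ (by linarith) (by norm_num)]; linarith
    calc _ ≤ ‖w i‖ ^ 2 * 2 / 2 := by gcongr
      _ = ‖w i‖ ^ 2 := by ring
      _ ≤ _ := by gcongr
  have hprod : ∏ i ∈ range m, (1 - i * (z / m ^ 2)) =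
      Complex.exp (∑ i ∈ range m, Complex.log (1 + w i)) := by
    rw [Complex.exp_sum]
    refine prod_congr rfl fun i hi => ?_
    rw [Complex.exp_log]
    · simp only [w]; ring
    · intro h0
      have h1 := hw i hi
      have : w i = -1 := by linear_combination h0
      rw [this] at h1
      simp at h1
      linarith
  have hsum : ∑ i ∈ range m, w i = -(z / 2) + z / (2 * m) := by
    have h := Finset.sum_range_id_mul_two m
    have h' : (∑ i ∈ range m, (i : ℂ)) * 2 = m * (m - 1) := by
      have := congrArg (Nat.cast : ℕ → ℂ) h
      push_cast [Nat.cast_sub (Nat.one_le_iff_ne_zero.2 hm.ne')] at this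
      exact this
    simp only [w]
    rw [sum_neg_distrib, ← sum_mul]
    have : ∑ i ∈ range m, (i : ℂ) = m * (m - 1) / 2 := by rw [← h']; ring
    rw [this]
    field_simp
    ring
  set S := ∑ i ∈ range m, Complex.log (1 + w i) with hS
  have hS1 : ‖S + ρ / 2‖ ≤ D := by
    have e : S + ρ / 2 = -((z - ρ) / 2) + z / (2 * m) +
        ∑ i ∈ range m, (Complex.log (1 + w i) - w i) := by
      rw [sum_sub_distrib, hsum, ← hS]
      ring
    have h3 : ‖∑ i ∈ range m, (Complex.log (1 + w i) - w i)‖ ≤ ‖z‖ ^ 2 / m := by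
      refine (norm_sum_le _ _).trans ((sum_le_sum hlog).trans ?_)
      rw [sum_const, card_range, nsmul_eq_mul]
      apply le_of_eq
      field_simp
    rw [e]
    refine (norm_add₃_le).trans (le_trans ?_ hD)
    gcongr
    · rw [norm_neg, norm_div]; simp
    · rw [norm_div, norm_mul]; simp
  rw [hprod]
  have e : Complex.exp S - ((Real.exp (-(ρ / 2)) : ℝ) : ℂ) =
      (Complex.exp (S + ρ / 2) - 1) * ((Real.exp (-(ρ / 2)) : ℝ) : ℂ) := by
    rw [sub_mul, Complex.ofReal_exp, ← Complex.exp_add]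
    push_cast
    ring_nf
  rw [e, norm_mul, Complex.norm_real, Real.norm_of_nonneg (Real.exp_pos _).le]
  have := Complex.norm_exp_sub_one_le (hS1.trans hD1)
  gcongr
  linarith

/-- `simpleFactor` carries the square of `gammaWeight`, so the averaging lemma is applied twice,
with the disc shrinking from `α + 8δ` to `α + 4δ` to `α`. -/
theorem norm_simpleFactor_mul_exp_sub_one_le {m : ℕ} (hm : 0 < m) {ρ α δ D : ℝ} (hρ : 0 ≤ ρ)
    (hα0 : 0 ≤ α) (hδ : 0 < δ) (hαδ : α + 4 * δ ≤ 1)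
    (hm4 : 4 * ρ / m ≤ 1 / 2)
    (hD : (α + 8 * δ) * ρ / 2 + 4 * ρ / (2 * m) + (4 * ρ) ^ 2 / m ≤ D) (hD1 : D ≤ 1)
    {z : ℂ} (hz : ‖z - ρ‖ ≤ α * ρ) :
    ‖simpleFactor m z * (Real.exp (ρ / 2) : ℝ) - 1‖ ≤
      2 * D + 12 * Real.exp (19 * ρ) * Real.exp (-(m * δ ^ 2 / 4)) := by
  have hm' : (0 : ℝ) < m := by exact_mod_cast hm
  set V := Real.exp (-(ρ / 2)) with hV
  have hV1 : V ≤ 1 := Real.exp_le_one_iff.2 (by linarith)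
  have hV0 : 0 < V := Real.exp_pos _
  let a : ℕ → ℂ := fun j => fallCoeff m j / (m : ℂ) ^ (2 * j)
  -- The limit value is subtracted from the constant coefficient. As `gammaWeight m 0 = 1`,
  -- averaging leaves this subtraction intact.
  let b : ℕ → ℂ := fun j => a j - if j = 0 then (V : ℂ) else 0
  have hbsum : ∀ g : ℕ → ℂ, g 0 = 1 → ∀ z : ℂ, ∑ j ∈ range (m + 1), b j * g j * z ^ j =
      (∑ j ∈ range (m + 1), a j * g j * z ^ j) - V := by
    intro g hg z
    simp only [b, sub_mul, sum_sub_distrib, ite_mul, zero_mul]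
    rw [sum_ite_eq']
    simp [hg]
  have hb : ∀ x : ℝ, 0 ≤ x → ∑ j ∈ range (m + 1), ‖b j‖ * x ^ j ≤ 2 * Real.exp (1 / 2 * x) := by
    intro x hx
    calc _ ≤ ∑ j ∈ range (m + 1), (‖a j‖ * x ^ j + if j = 0 then V else 0) := by
          refine sum_le_sum fun j _ => ?_
          have : ‖b j‖ ≤ ‖a j‖ + if j = 0 then V else 0 := by
            refine (norm_sub_le _ _).trans ?_
            gcongr
            split_ifs
            · rw [Complex.norm_real, Real.norm_of_nonneg hV0.le]
            · simp
          refine (mul_le_mul_of_nonneg_right this (by positivity)).trans ?_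
          rw [add_mul]
          gcongr
          split_ifs with h
          · simp [h]
          · simp
      _ ≤ Real.exp (1 / 2 * x) + V := by
          rw [sum_add_distrib, sum_ite_eq']
          have := sum_norm_fallCoeff_div_le hm hx
          simp only [mem_range, Nat.zero_lt_succ, if_true]
          gcongr
      _ ≤ _ := by
          have := Real.one_le_exp (x := 1 / 2 * x) (by positivity)
          linarith
  have hb2 : ∀ x : ℝ, 0 ≤ x → ∑ j ∈ range (m + 1), ‖b j * gammaWeight m j‖ * x ^ j ≤
      2 * Real.exp (3 / 2 * x) := by
    intro x hx
    refine (sum_le_sum fun j hj => ?_).trans ((hb (3 * x) (by positivity)).trans_eq (by ring_nf))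
    have hj' : j ≤ m := by simpa [Nat.lt_succ_iff] using hj
    have hg := gammaWeight_le hj'
    rw [norm_mul, Complex.norm_real, Real.norm_of_nonneg (gammaWeight_nonneg m j), mul_pow, mul_assoc]
    gcongr
  have hP : ∀ z : ℂ, ‖z - ρ‖ ≤ ((α + 4 * δ) + 4 * δ) * ρ →
      ‖∑ j ∈ range (m + 1), b j * z ^ j‖ ≤ 2 * D * V := by
    intro z hz
    have h0 := hbsum (fun _ => 1) rfl z
    simp only [mul_one] at h0
    have h1 := prod_add_mul_eq_sum_fallCoeff m 1 (z / m ^ 2)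
    have h2 : ∑ j ∈ range (m + 1), a j * z ^ j = ∏ i ∈ range m, (1 - i * (z / m ^ 2)) := by
      rw [h1]
      refine sum_congr rfl fun j _ => ?_
      simp only [a, one_pow, mul_one]
      rw [div_pow, ← pow_mul]
      ring
    have hzn : ‖z‖ ≤ 4 * ρ := by
      calc ‖z‖ = ‖(z - ρ) + ρ‖ := by simp
        _ ≤ ‖z - ρ‖ + ‖(ρ : ℂ)‖ := norm_add_le _ _
        _ ≤ ((α + 4 * δ) + 4 * δ) * ρ + ρ := by
          rw [Complex.norm_real, Real.norm_of_nonneg hρ]; gcongr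
        _ ≤ 4 * ρ := by nlinarith
    rw [h0, h2]
    refine norm_prod_mul_exp_sub_one_le hm (le_trans (by gcongr) hm4) (le_trans ?_ hD) hD1
    gcongr
    linarith
  have hδ2 : δ ≤ 1 / 2 := by linarith
  have step1 := fun (z : ℂ) (hz : ‖z - ρ‖ ≤ (α + 4 * δ) * ρ) =>
    norm_gammaAverage_le hm (by norm_num) (by norm_num) hρ hαδ hδ hδ2 hb hP hz
  have step2 := norm_gammaAverage_le hm (by norm_num) (by norm_num) hρ (by linarith) hδ hδ2 hb2
    step1 hz
  have h3 := hbsum (fun j => (gammaWeight m j : ℂ) * gammaWeight m j) (by simp [gammaWeight_zero]) z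
  simp only [← mul_assoc] at h3
  rw [h3, ← simpleFactor_eq hm] at step2
  have hVi : V * Real.exp (ρ / 2) = 1 := by rw [← Real.exp_add]; simp
  have e : simpleFactor m z * (Real.exp (ρ / 2) : ℝ) - 1 =
      (simpleFactor m z - V) * (Real.exp (ρ / 2) : ℝ) := by
    have : (V : ℂ) * (Real.exp (ρ / 2) : ℝ) = 1 := by exact_mod_cast hVi
    rw [sub_mul, this]
  rw [e, norm_mul, Complex.norm_real, Real.norm_of_nonneg (Real.exp_pos _).le]
  set Y := Real.exp (-(m * δ ^ 2 / 4))
  have hY : 0 < Y := Real.exp_pos _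
  calc _ ≤ (2 * D * V + 3 * 2 * Real.exp (12 * (1 / 2) * ρ) * Y +
        3 * 2 * Real.exp (12 * (3 / 2) * ρ) * Y) * Real.exp (ρ / 2) := by gcongr
    _ = 2 * D * (V * Real.exp (ρ / 2)) +
        6 * (Real.exp (12 * (1 / 2) * ρ) * Real.exp (ρ / 2)) * Y +
        6 * (Real.exp (12 * (3 / 2) * ρ) * Real.exp (ρ / 2)) * Y := by ring
    _ ≤ 2 * D * 1 + 6 * Real.exp (19 * ρ) * Y + 6 * Real.exp (19 * ρ) * Y := by
        rw [hVi, ← Real.exp_add, ← Real.exp_add]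
        gcongr <;> linarith
    _ = _ := by ring

end Dicore

/-! ### Second-order expansion of the centred characteristic function. -/

namespace Dicore

open MeasureTheory Complex Finset Filter Topology
open scoped Real

theorem norm_exp_mul_I_sub_le (x : ℝ) :
    ‖exp (x * I) - (1 + x * I - x ^ 2 / 2)‖ ≤ 4 * |x| ^ 3 := by
  have hn : ‖(x : ℂ) * I‖ = |x| := by simp
  rcases le_total |x| 1 with h | h
  · have h1 := norm_exp_sub_sum_le_norm_mul_exp (x * I) 3
    have e : ∑ j ∈ range 3, ((x : ℂ) * I) ^ j / j.factorial = 1 + x * I - x ^ 2 / 2 := by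
      simp [sum_range_succ, Nat.factorial, mul_pow]
      ring
    rw [e, hn] at h1
    refine h1.trans ?_
    have : Real.exp |x| ≤ 4 := by
      have := Real.exp_le_exp.2 h
      linarith [Real.exp_one_lt_d9]
    calc _ ≤ |x| ^ 3 * 4 := by gcongr
      _ = _ := by ring
  · have h2 : ‖(1 : ℂ) + x * I - x ^ 2 / 2‖ ≤ 1 + |x| + |x| ^ 2 / 2 := by
      refine (norm_sub_le _ _).trans ?_
      gcongr
      · refine (norm_add_le _ _).trans ?_
        simp
      · simp
    have h3 := norm_sub_le (exp (x * I)) (1 + x * I - x ^ 2 / 2)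
    rw [norm_exp_ofReal_mul_I] at h3
    have h4 : |x| ^ 2 ≥ |x| := by nlinarith
    have h5 : |x| ^ 3 ≥ |x| ^ 2 := by nlinarith [mul_nonneg (abs_nonneg x) (abs_nonneg x)]
    linarith

theorem hasSum_pow_div_factorial_mul_descFactorial (x : ℝ) (r : ℕ) :
    HasSum (fun k : ℕ => x ^ k / k.factorial * (k.descFactorial r : ℝ)) (x ^ r * Real.exp x) := by
  rw [← hasSum_nat_add_iff' r]
  have h0 : ∑ i ∈ range r, x ^ i / i.factorial * (i.descFactorial r : ℝ) = 0 :=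
    sum_eq_zero fun i hi => by
      rw [Nat.descFactorial_of_lt (mem_range.1 hi)]; simp
  rw [h0, sub_zero]
  have h := (NormedSpace.expSeries_div_hasSum_exp x).mul_left (x ^ r)
  rw [← Real.exp_eq_exp_ℝ] at h
  refine hasSum_of_eq h (fun k => ?_) rfl
  have h1 := Nat.factorial_mul_descFactorial (Nat.le_add_left r k)
  rw [Nat.add_sub_cancel] at h1
  have h2 : ((k + r).factorial : ℝ) = k.factorial * ((k + r).descFactorial r : ℝ) := by
    exact_mod_cast h1.symm
  have h3 : ((k + r).factorial : ℝ) ≠ 0 := by exact_mod_cast (k + r).factorial_ne_zero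
  have h4 : (k.factorial : ℝ) ≠ 0 := by exact_mod_cast k.factorial_ne_zero
  have h5 : ((k + r).descFactorial r : ℝ) ≠ 0 := by
    intro h; rw [h] at h2; simp at h2; exact h3 (by rw [h2]; simp)
  rw [h2, pow_add]
  field_simp

/-- Since `1 ≤ c ≤ 1 + lam`, the deviation is at most `lam` below the mean and at most `k` above it;
factorial moments of the Poisson law then bound its third moment. -/
theorem abs_sub_pow_three_le {c lam : ℝ} (hc : 1 ≤ c) (hcl : c ≤ 1 + lam) (k : ℕ) :
    |((k + 1 : ℕ) : ℝ) - c| ^ 3 ≤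
      ((k + 1).descFactorial 3 : ℝ) + ((k + 1).descFactorial 2 : ℝ) + lam ^ 3 := by
  have hk : (0 : ℝ) ≤ k := by positivity
  have h1 : (k : ℝ) ^ 3 ≤ ((k + 1).descFactorial 3 : ℝ) + ((k + 1).descFactorial 2 : ℝ) := by
    rcases k with _ | k
    · simp
    · simp only [Nat.descFactorial_succ, Nat.descFactorial_zero]
      simp
      ring_nf
      nlinarith [(Nat.cast_nonneg k : (0 : ℝ) ≤ k)]
  rcases le_total ((k + 1 : ℕ) : ℝ) c with h | h
  · have : |((k + 1 : ℕ) : ℝ) - c| ≤ lam := by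
      rw [abs_of_nonpos (by linarith)]; push_cast; linarith
    have h2 : |((k + 1 : ℕ) : ℝ) - c| ^ 3 ≤ lam ^ 3 := by gcongr
    have : (0 : ℝ) ≤ (k : ℝ) ^ 3 := by positivity
    linarith
  · have : |((k + 1 : ℕ) : ℝ) - c| ≤ k := by
      rw [abs_of_nonneg (by linarith)]; push_cast; linarith
    have h2 : |((k + 1 : ℕ) : ℝ) - c| ^ 3 ≤ (k : ℝ) ^ 3 := by gcongr
    have : (0 : ℝ) ≤ lam ^ 3 := by
      have : 0 ≤ lam := by linarith
      positivity
    linarith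

/-- Taylor expansion under the truncated Poisson mean: the parameter equation kills the linear term,
and the third absolute moment bounds the error. The factor `lam` in the bound matches the order of
the variance, as small `lam` requires. -/
theorem norm_chi_mul_exp_sub_le {c lam : ℝ} (h : IsParam c lam) (θ : ℝ) :
    ‖chi lam θ * exp (-(c * θ * I)) - (1 - c * (1 + lam - c) * θ ^ 2 / 2)‖ ≤
      8 * |θ| ^ 3 * (lam * (1 + lam) ^ 2) := by
  have hl := h.1
  have hc1 := h.one_lt
  have hc2 := h.le_one_add
  obtain ⟨-, hE⟩ := isParam_iff.1 h
  have hE0 : 0 < Real.exp lam - 1 := by linarith [Real.add_one_lt_exp hl.ne']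
  have hEC : exp (lam : ℂ) - 1 ≠ 0 := by exact_mod_cast hE0.ne'
  have hEC2 : (c : ℂ) * (exp lam - 1) = lam * exp lam := by exact_mod_cast hE
  let f : ℕ → ℂ := fun k => ((lam ^ k / k.factorial : ℝ) : ℂ) *
    (exp ((θ * (k - c) : ℝ) * I) - (1 + (θ * (k - c) : ℝ) * I - (θ * (k - c) : ℝ) ^ 2 / 2))
  have hf : HasSum f (exp (-(c * θ * I)) * exp (lam * exp (θ * I)) - (exp lam +
      θ * I * (lam * exp lam - c * exp lam) -
        θ ^ 2 / 2 * ((lam ^ 2 + lam) * exp lam - 2 * c * (lam * exp lam) + c ^ 2 * exp lam))) := by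
    have m : ∀ r, HasSum (fun k : ℕ => ((lam ^ k / k.factorial : ℝ) : ℂ) *
        (k.descFactorial r : ℂ)) (lam ^ r * exp lam) := by
      intro r
      have := (Complex.hasSum_ofReal).2 (hasSum_pow_div_factorial_mul_descFactorial lam r)
      push_cast at this ⊢
      exact this
    have e0 := (NormedSpace.expSeries_div_hasSum_exp (lam * exp (θ * I))).mul_left
      (exp (-(c * θ * I)))
    rw [← exp_eq_exp_ℂ] at e0
    have m0 := m 0
    have m1 := m 1
    have m2 := m 2
    have tot := e0.sub ((m0.add ((m1.sub (m0.mul_left (c : ℂ))).mul_left (θ * I))).sub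
      (((((m2.add m1)).sub (m1.mul_left (2 * c : ℂ))).add (m0.mul_left (c ^ 2 : ℂ))).mul_left
        (θ ^ 2 / 2 : ℂ)))
    refine hasSum_of_eq tot (fun k => ?_) ?_
    · have hk2 : ((k.descFactorial 2 : ℕ) : ℂ) = k ^ 2 - k := by
        rcases k with _ | k
        · simp
        · simp [Nat.descFactorial_succ]; ring
      have hexp : exp ((θ * (k - c) : ℝ) * I) = exp (-(c * θ * I)) * exp (θ * I) ^ k := by
        rw [← exp_nat_mul, ← exp_add]
        congr 1
        push_cast
        ring
      simp only [f, hexp, hk2, Nat.descFactorial_zero, Nat.descFactorial_one]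
      push_cast
      rw [mul_pow]
      ring_nf
    · ring
  -- Removing the term `k = 0` is the truncation; it lets `e^lam - 1` factor out of the error bound.
  have hf1 := (hasSum_nat_add_iff' 1).2 hf
  rw [sum_range_one] at hf1
  have hg : HasSum (fun k : ℕ => 4 * |θ| ^ 3 * (lam ^ k / k.factorial *
      ((k.descFactorial 3 : ℝ) + (k.descFactorial 2 : ℝ) + lam ^ 3)))
      (4 * |θ| ^ 3 * (lam ^ 3 * Real.exp lam + lam ^ 2 * Real.exp lam + lam ^ 3 * Real.exp lam)) := by
    have m := hasSum_pow_div_factorial_mul_descFactorial lam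
    have tot := (((m 3).add (m 2)).add ((m 0).mul_left (lam ^ 3))).mul_left (4 * |θ| ^ 3)
    refine hasSum_of_eq tot (fun k => ?_) ?_
    · simp only [Nat.descFactorial_zero]
      push_cast
      ring
    · ring
  have hg1 := (hasSum_nat_add_iff' 1).2 hg
  rw [sum_range_one] at hg1
  have hle := hf1.norm_le_of_bounded hg1 fun k => by
    simp only [f]
    rw [norm_mul, norm_real, Real.norm_of_nonneg (by positivity)]
    have h1 := norm_exp_mul_I_sub_le (θ * ((k + 1 : ℕ) - c))
    have h2 := abs_sub_pow_three_le hc1.le hc2 k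
    rw [abs_mul, mul_pow] at h1
    have h3 : 4 * (|θ| ^ 3 * |((k + 1 : ℕ) : ℝ) - c| ^ 3) ≤ 4 * (|θ| ^ 3 *
      (((k + 1).descFactorial 3 : ℝ) + ((k + 1).descFactorial 2 : ℝ) + lam ^ 3)) := by gcongr
    calc _ ≤ (lam ^ (k + 1) / (k + 1).factorial) * _ :=
          mul_le_mul_of_nonneg_left (h1.trans h3) (by positivity)
      _ = _ := by ring
  have e1 : chi lam θ * exp (-(c * θ * I)) - (1 - c * (1 + lam - c) * θ ^ 2 / 2) =
      (exp (-(c * θ * I)) * exp (lam * exp (θ * I)) - (exp lam +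
      θ * I * (lam * exp lam - c * exp lam) -
        θ ^ 2 / 2 * ((lam ^ 2 + lam) * exp lam - 2 * c * (lam * exp lam) + c ^ 2 * exp lam)) - f 0) /
      (exp lam - 1) := by
    rw [eq_div_iff hEC]
    have hf0 : f 0 = exp (-(c * θ * I)) - (1 - θ * c * I - θ ^ 2 * c ^ 2 / 2) := by
      simp only [f]
      push_cast
      simp only [pow_zero, Nat.factorial_zero, Nat.cast_one, div_one, one_mul, zero_sub]
      have : (θ : ℂ) * -c * I = -(c * θ * I) := by ring
      rw [this]
      ring
    rw [hf0, chi]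
    field_simp
    linear_combination (θ * I * 2 - (lam + 1 - 2 * c) * θ ^ 2) * (- hEC2)
  rw [e1, norm_div]
  have hnE : ‖exp (lam : ℂ) - 1‖ = Real.exp lam - 1 := by
    rw [← ofReal_exp, ← ofReal_one, ← ofReal_sub, norm_real, Real.norm_of_nonneg hE0.le]
  rw [hnE, div_le_iff₀ hE0]
  refine hle.trans ?_
  simp only [Nat.descFactorial, pow_zero, Nat.factorial_zero]
  have e2 : lam ^ 3 * Real.exp lam + lam ^ 2 * Real.exp lam + lam ^ 3 * Real.exp lam - lam ^ 3 =
      (c * (lam ^ 2 + lam) + lam ^ 3) * (Real.exp lam - 1) := by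
    linear_combination (-(lam ^ 2 + lam)) * hE
  have e3 : c * (lam ^ 2 + lam) + lam ^ 3 ≤ 2 * (lam * (1 + lam) ^ 2) := by
    nlinarith [mul_le_mul_of_nonneg_right hc2 (by positivity : 0 ≤ lam ^ 2 + lam),
      pow_pos hl 2]
  calc _ = 4 * |θ| ^ 3 * ((c * (lam ^ 2 + lam) + lam ^ 3) * (Real.exp lam - 1)) := by
        rw [← e2]; push_cast; ring
    _ ≤ 4 * |θ| ^ 3 * ((2 * (lam * (1 + lam) ^ 2)) * (Real.exp lam - 1)) := by gcongr
    _ = _ := by ring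

theorem norm_pow_sub_pow_le {z w : ℂ} (hz : ‖z‖ ≤ 1) (hw : ‖w‖ ≤ 1) (n : ℕ) :
    ‖z ^ n - w ^ n‖ ≤ n * ‖z - w‖ := by
  induction n with
  | zero => simp
  | succ n ih =>
    have e : z ^ (n + 1) - w ^ (n + 1) = z ^ n * (z - w) + (z ^ n - w ^ n) * w := by ring
    rw [e]
    refine (norm_add_le _ _).trans ?_
    rw [norm_mul, norm_mul, norm_pow]
    have h1 : ‖z‖ ^ n * ‖z - w‖ ≤ 1 * ‖z - w‖ := by
      gcongr; exact pow_le_one₀ (norm_nonneg _) hz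
    have h2 : ‖z ^ n - w ^ n‖ * ‖w‖ ≤ ‖z ^ n - w ^ n‖ * 1 := by gcongr
    push_cast
    linarith

end Dicore

/-! ### Local limit theorem for a single Cauchy integral. -/

namespace Dicore

open MeasureTheory Complex Finset Filter Topology
open scoped Real

/-- A sequence of parameters for which `n * lam` grows faster than every fixed power of
`1 + lam` that the estimates need. -/
structure Admissible (n m : ℕ → ℕ) (lam : ℕ → ℝ) : Prop where
  isParam : ∀ k, IsParam ((m k : ℝ) / n k) (lam k)
  tendsto : Tendsto (fun k => n k * lam k / (1 + lam k) ^ 16) atTop atTop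

namespace Admissible

variable {n m : ℕ → ℕ} {lam : ℕ → ℝ}

theorem lam_pos (h : Admissible n m lam) (k : ℕ) : 0 < lam k := (h.isParam k).1

theorem n_pos (h : Admissible n m lam) (k : ℕ) : 0 < n k := by
  rcases Nat.eq_zero_or_pos (n k) with h0 | h0
  · have := (h.isParam k).one_lt
    rw [h0] at this
    simp at this
    linarith
  · exact h0

theorem mul_lam_le (h : Admissible n m lam) (k : ℕ) : n k * lam k ≤ m k := by
  have h0 : (0 : ℝ) < n k := by exact_mod_cast h.n_pos k
  have := (h.isParam k).lt
  rw [lt_div_iff₀ h0] at this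
  linarith

theorem mul_lam_pos (h : Admissible n m lam) (k : ℕ) : 0 < n k * lam k :=
  mul_pos (by exact_mod_cast h.n_pos k) (h.lam_pos k)

theorem m_pos (h : Admissible n m lam) (k : ℕ) : 0 < m k := by
  have := (h.mul_lam_pos k).trans_le (h.mul_lam_le k)
  exact_mod_cast this

theorem tendsto_mul_lam (h : Admissible n m lam) :
    Tendsto (fun k => n k * lam k) atTop atTop := by
  refine tendsto_atTop_mono (fun k => ?_) h.tendsto
  have := h.lam_pos k
  exact div_le_self (h.mul_lam_pos k).le (one_le_pow₀ (by linarith))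

theorem tendsto_n (h : Admissible n m lam) : Tendsto (fun k => (n k : ℝ)) atTop atTop := by
  refine tendsto_atTop_mono (fun k => ?_) h.tendsto
  have h0 := h.lam_pos k
  have h1 : 1 + lam k ≤ (1 + lam k) ^ 16 := le_self_pow₀ (by linarith) (by norm_num)
  rw [div_le_iff₀ (by positivity)]
  gcongr
  linarith

theorem tendsto_pow_div (h : Admissible n m lam) {p : ℕ} (hp : p ≤ 16) :
    Tendsto (fun k => (1 + lam k) ^ p / (n k * lam k)) atTop (𝓝 0) := by
  refine squeeze_zero (fun k => ?_) (fun k => ?_) h.tendsto.inv_tendsto_atTop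
  · have := h.lam_pos k
    positivity
  · have := h.lam_pos k
    have h2 := h.mul_lam_pos k
    simp only [Pi.inv_apply, inv_div]
    gcongr
    linarith

theorem le_variance (h : Admissible n m lam) (k : ℕ) :
    n k * lam k / 2 ≤ n k * ((m k : ℝ) / n k * (1 + lam k - m k / n k)) := by
  have := (h.isParam k).le_variance
  have h0 : (0 : ℝ) ≤ n k := by positivity
  nlinarith [mul_le_mul_of_nonneg_left this h0]

/-- Rescale the angle by the standard deviation `s` and use dominated convergence to the Gaussian
integral. The majorant comes from `norm_chi_le` and variance at most `lam`; pointwise, the `n`-th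
powers are compared through their bases. -/
theorem tendsto_integral_mul_sqrt (h : Admissible n m lam) :
    Tendsto (fun k => (∫ φ, chi (lam k) φ ^ n k * exp (-(m k * φ * I)) ∂circleMeasure) *
      (√(n k * ((m k : ℝ) / n k * (1 + lam k - m k / n k))) : ℝ)) atTop (𝓝 (√(2 * π) : ℝ)) := by
  set c : ℕ → ℝ := fun k => (m k : ℝ) / n k with hc
  set v : ℕ → ℝ := fun k => c k * (1 + lam k - c k) with hv
  set s : ℕ → ℝ := fun k => √(n k * v k) with hs
  have hnv : ∀ k, n k * lam k / 2 ≤ n k * v k := h.le_variance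
  have hn0 : ∀ k, (0 : ℝ) < n k := fun k => by exact_mod_cast h.n_pos k
  have hnv0 : ∀ k, 0 < n k * v k := fun k => by
    have := hnv k; have := h.mul_lam_pos k; linarith
  have hs0 : ∀ k, 0 < s k := fun k => Real.sqrt_pos.2 (hnv0 k)
  have hs2 : ∀ k, s k ^ 2 = n k * v k := fun k => Real.sq_sqrt (hnv0 k).le
  let F : ℕ → ℝ → ℂ := fun k => (Set.Ioc (-π) π).indicator
    fun φ => chi (lam k) φ ^ n k * exp (-(m k * φ * I))
  have hF : ∀ k, (∫ φ, chi (lam k) φ ^ n k * exp (-(m k * φ * I)) ∂circleMeasure) * (s k : ℝ) =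
      ∫ x, F k (x / s k) := by
    intro k
    rw [Measure.integral_comp_div (F k), abs_of_pos (hs0 k), circleMeasure,
      integral_indicator measurableSet_Ioc, real_smul, mul_comm]
  have hgauss : ((√(2 * π) : ℝ) : ℂ) = ∫ x : ℝ, ((Real.exp (-(1 / 2) * x ^ 2) : ℝ) : ℂ) := by
    rw [integral_complex_ofReal, integral_gaussian]
    congr 2
    ring
  change Tendsto (fun k => (∫ φ, chi (lam k) φ ^ n k * exp (-(m k * φ * I)) ∂circleMeasure) *
    (s k : ℝ)) atTop _
  simp_rw [hF]
  rw [hgauss]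
  refine tendsto_integral_of_dominated_convergence (fun x => Real.exp (-(1 / π ^ 2) * x ^ 2))
    (fun k => ?_) (integrable_exp_neg_mul_sq (by positivity)) (fun k => ae_of_all _ fun x => ?_)
    (ae_of_all _ fun x => ?_)
  · have : Measurable (F k) := Measurable.indicator (by fun_prop) measurableSet_Ioc
    exact (this.comp (measurable_id.div_const _)).aestronglyMeasurable
  · by_cases hx : x / s k ∈ Set.Ioc (-π) π
    · simp only [F, Set.indicator_of_mem hx]
      have e : exp (-(m k * ((x / s k : ℝ) : ℂ) * I)) =
          exp ((-(m k * (x / s k)) : ℝ) * I) := by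
        congr 1; push_cast; ring
      rw [norm_mul, e, norm_exp_ofReal_mul_I, mul_one, norm_pow]
      have h1 := norm_chi_le (h.lam_pos k) (abs_le.2 ⟨hx.1.le, hx.2⟩)
      calc _ ≤ Real.exp (-(lam k * (x / s k) ^ 2 / π ^ 2)) ^ n k := by gcongr
        _ ≤ _ := by
          rw [← Real.exp_nat_mul]
          apply Real.exp_le_exp.2
          rw [div_pow, hs2]
          have h2 : v k ≤ lam k := (h.isParam k).variance_le
          have hv0 : 0 < v k := pos_of_mul_pos_right (hnv0 k) (hn0 k).le
          have h3 : 1 ≤ lam k / v k := (one_le_div hv0).2 h2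
          have e2 : (n k : ℝ) * -(lam k * (x ^ 2 / (n k * v k)) / π ^ 2) =
            -(lam k / v k * (x ^ 2 / π ^ 2)) := by
            have := hn0 k
            field_simp
          have e3 : -(1 / π ^ 2) * x ^ 2 = -(1 * (x ^ 2 / π ^ 2)) := by ring
          rw [e2, e3]
          gcongr
    · simp only [F, Set.indicator_of_notMem hx, norm_zero]
      positivity
  · have hsT : Tendsto s atTop atTop := by
      refine Real.tendsto_sqrt_atTop.comp (tendsto_atTop_mono hnv ?_)
      exact h.tendsto_mul_lam.atTop_div_const (by norm_num)
    have hxs : Tendsto (fun k => x / s k) atTop (𝓝 0) := hsT.const_div_atTop x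
    rw [tendsto_iff_norm_sub_tendsto_zero]
    -- The cubic error, multiplied by `n`, is of order `n lam (1 + lam)^2 / s^3`, and `s^2 ≥ n lam /
    -- 2`.
    have hB1 : Tendsto (fun k => (1 + lam k) ^ 2 / s k) atTop (𝓝 0) := by
      have h1 := (h.tendsto_pow_div (p := 4) (by norm_num)).const_mul 2
      have h2 := (Real.continuous_sqrt.tendsto _).comp h1
      simp only [mul_zero, Real.sqrt_zero] at h2
      refine squeeze_zero (fun k => ?_) (fun k => ?_) h2
      · have := h.lam_pos k; have := hs0 k; positivity
      · simp only [Function.comp]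
        apply Real.le_sqrt_of_sq_le
        rw [div_pow, hs2, ← pow_mul]
        have h3 := h.mul_lam_pos k
        have h4 := hnv k
        have h5 := h.lam_pos k
        calc _ ≤ (1 + lam k) ^ 4 / (n k * lam k / 2) := by gcongr
          _ = _ := by field_simp
    have hB2 : Tendsto (fun k => x ^ 4 / 4 / (n k : ℝ)) atTop (𝓝 0) :=
      h.tendsto_n.const_div_atTop _
    have hB := (hB1.const_mul (16 * |x| ^ 3)).add hB2
    rw [mul_zero, add_zero] at hB
    refine squeeze_zero' (Eventually.of_forall fun k => norm_nonneg _) ?_ hB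
    have ev1 : ∀ᶠ k in atTop, x / s k ∈ Set.Ioo (-π) π :=
      hxs (Ioo_mem_nhds (by linarith [Real.pi_pos]) Real.pi_pos)
    have ev2 : ∀ᶠ k in atTop, x ^ 2 / 2 / (n k : ℝ) ≤ 1 :=
      (h.tendsto_n.const_div_atTop (x ^ 2 / 2)).eventually_le_const (by norm_num)
    filter_upwards [ev1, ev2] with k hk hk2
    have hnk := hn0 k
    have hmem : x / s k ∈ Set.Ioc (-π) π := ⟨hk.1, hk.2.le⟩
    simp only [F, Set.indicator_of_mem hmem]
    set θ := x / s k with hθ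
    have hz : chi (lam k) θ ^ n k * exp (-(m k * θ * I)) =
        (chi (lam k) θ * exp (-(c k * θ * I))) ^ n k := by
      rw [mul_pow, ← exp_nat_mul]
      congr 2
      have hne : (n k : ℂ) ≠ 0 := by exact_mod_cast hnk.ne'
      simp only [hc]
      push_cast
      field_simp
    have hw : ((Real.exp (-(1 / 2) * x ^ 2) : ℝ) : ℂ) =
        ((Real.exp (-(x ^ 2 / 2 / n k)) : ℝ) : ℂ) ^ n k := by
      rw [← ofReal_pow, ← Real.exp_nat_mul]
      congr 2
      field_simp
    rw [hz, hw]
    have hz1 : ‖chi (lam k) θ * exp (-(c k * θ * I))‖ ≤ 1 := by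
      have e : exp (-(c k * θ * I)) = exp ((-(c k * θ) : ℝ) * I) := by
        congr 1; push_cast; ring
      rw [norm_mul, e, norm_exp_ofReal_mul_I, mul_one]
      refine (norm_chi_le (h.lam_pos k) (abs_le.2 ⟨hk.1.le, hk.2.le⟩)).trans ?_
      have := h.lam_pos k
      exact Real.exp_le_one_iff.2 (neg_nonpos.2 (by positivity))
    have hw1 : ‖((Real.exp (-(x ^ 2 / 2 / n k)) : ℝ) : ℂ)‖ ≤ 1 := by
      rw [norm_real, Real.norm_of_nonneg (Real.exp_pos _).le]
      exact Real.exp_le_one_iff.2 (neg_nonpos.2 (by positivity))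
    refine (norm_pow_sub_pow_le hz1 hw1 _).trans ?_
    have hθ2 : v k * θ ^ 2 / 2 = x ^ 2 / 2 / n k := by
      have hv0 : 0 < v k := pos_of_mul_pos_right (hnv0 k) (hn0 k).le
      rw [hθ, div_pow, hs2]
      field_simp
    have hA := norm_chi_mul_exp_sub_le (h.isParam k) θ
    have hAe : (1 - (c k : ℂ) * (1 + lam k - c k) * θ ^ 2 / 2) = ((1 - x ^ 2 / 2 / n k : ℝ) : ℂ) := by
      rw [← hθ2]
      simp only [hv]
      push_cast
      ring
    change ‖chi (lam k) θ * exp (-(c k * θ * I)) - (1 - (c k : ℂ) * (1 + lam k - c k) * θ ^ 2 / 2)‖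
      ≤ _ at hA
    rw [hAe] at hA
    have hBd : ‖((1 - x ^ 2 / 2 / n k : ℝ) : ℂ) - ((Real.exp (-(x ^ 2 / 2 / n k)) : ℝ) : ℂ)‖ ≤
        (x ^ 2 / 2 / n k) ^ 2 := by
      rw [← ofReal_sub, norm_real]
      have hy : ‖-(x ^ 2 / 2 / (n k : ℝ))‖ ≤ 1 := by
        rw [norm_neg, Real.norm_of_nonneg (by positivity)]; exact hk2
      have := Real.norm_exp_sub_one_sub_id_le hy
      rw [norm_neg, Real.norm_of_nonneg (by positivity : 0 ≤ x ^ 2 / 2 / (n k : ℝ))] at this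
      rw [← norm_neg, show -(1 - x ^ 2 / 2 / (n k : ℝ) - Real.exp (-(x ^ 2 / 2 / n k))) =
        Real.exp (-(x ^ 2 / 2 / n k)) - 1 - -(x ^ 2 / 2 / n k) by ring]
      exact this
    have htri : ‖chi (lam k) θ * exp (-(c k * θ * I)) - ((Real.exp (-(x ^ 2 / 2 / n k)) : ℝ) : ℂ)‖ ≤
        8 * |θ| ^ 3 * (lam k * (1 + lam k) ^ 2) + (x ^ 2 / 2 / n k) ^ 2 :=
      (norm_sub_le_norm_sub_add_norm_sub _ _ _).trans (add_le_add hA hBd)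
    have hl := h.lam_pos k
    have hsk := hs0 k
    have habs : |θ| ^ 3 = |x| ^ 3 / s k ^ 3 := by rw [hθ, abs_div, abs_of_pos hsk, div_pow]
    calc _ ≤ (n k : ℝ) * (8 * |θ| ^ 3 * (lam k * (1 + lam k) ^ 2) + (x ^ 2 / 2 / n k) ^ 2) := by
          gcongr
      _ = 8 * |x| ^ 3 * (1 + lam k) ^ 2 * (n k * lam k) / s k ^ 3 + x ^ 4 / 4 / n k := by
          rw [habs]
          field_simp
          ring
      _ ≤ 8 * |x| ^ 3 * (1 + lam k) ^ 2 * (2 * s k ^ 2) / s k ^ 3 + x ^ 4 / 4 / n k := by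
          have h2 : n k * lam k ≤ 2 * s k ^ 2 := by
            have := hnv k
            rw [hs2]
            linarith
          exact add_le_add (div_le_div_of_nonneg_right
            (mul_le_mul_of_nonneg_left h2 (by positivity)) (by positivity)) le_rfl
      _ = _ := by
          field_simp
          ring

end Admissible

end Dicore

/-! ### Replacing `simpleFactor` by its limit inside the double integral. -/

namespace Dicore

open MeasureTheory Complex Finset Filter Topology
open scoped Real

theorem norm_chi_mul_chi_le {lam φ ψ : ℝ} (hl : 0 < lam) (hφ : |φ| ≤ π) (hψ : |ψ| ≤ π) (n : ℕ) :
    ‖chi lam φ ^ n * chi lam ψ ^ n‖ ≤ Real.exp (-(n * lam / π ^ 2 * (φ ^ 2 + ψ ^ 2))) := by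
  rw [norm_mul, norm_pow, norm_pow]
  have h1 := norm_chi_le hl hφ
  have h2 := norm_chi_le hl hψ
  calc _ ≤ Real.exp (-(lam * φ ^ 2 / π ^ 2)) ^ n * Real.exp (-(lam * ψ ^ 2 / π ^ 2)) ^ n := by
        gcongr
    _ = _ := by
        rw [← Real.exp_nat_mul, ← Real.exp_nat_mul, ← Real.exp_add]
        congr 1
        ring

namespace Admissible

variable {n m : ℕ → ℕ} {lam : ℕ → ℝ}

set_option maxHeartbeats 400000 in
-- The product of the `chi` powers is at most `G * G` for a Gaussian `G`. One `G` is kept for the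
-- later integration. If both angles are at most `1 / q`, with `q = (n lam)^(1/4)`, `simpleFactor`
-- is close to its limit; otherwise the second `G` is at most `exp (-q^2 / 20)` and beats the crude
-- bound.
theorem exists_error_bound (h : Admissible n m lam) : ∃ E : ℕ → ℝ, Tendsto E atTop (𝓝 0) ∧
    ∀ᶠ k in atTop, ∀ φ ψ : ℝ, |φ| ≤ π → |ψ| ≤ π →
      ‖chi (lam k) φ ^ n k * chi (lam k) ψ ^ n k *
        (simpleFactor (m k) (lam k ^ 2 * exp ((φ + ψ) * I)) * (Real.exp (lam k ^ 2 / 2) : ℝ) - 1)‖ ≤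
      E k * (Real.exp (-(n k * lam k / (2 * π ^ 2)) * φ ^ 2) *
        Real.exp (-(n k * lam k / (2 * π ^ 2)) * ψ ^ 2)) := by
  set q : ℕ → ℝ := fun k => √(√(n k * lam k)) with hq
  set B : ℕ → ℝ := fun k => (1 + lam k) ^ 4 / q k with hB
  have hqT : Tendsto q atTop atTop :=
    Real.tendsto_sqrt_atTop.comp (Real.tendsto_sqrt_atTop.comp h.tendsto_mul_lam)
  have hq2 : ∀ k, q k ^ 2 = √(n k * lam k) := fun k => Real.sq_sqrt (Real.sqrt_nonneg _)
  have hq4 : ∀ k, q k ^ 4 = n k * lam k := fun k => by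
    rw [show q k ^ 4 = (q k ^ 2) ^ 2 by ring, hq2, Real.sq_sqrt (h.mul_lam_pos k).le]
  -- `B^4 = (1 + lam)^16 / (n lam)`, which is where the exponent 16 in `Admissible` comes from.
  have hBT : Tendsto B atTop (𝓝 0) := by
    have h1 := h.tendsto_pow_div (p := 16) le_rfl
    have h2 := (Real.continuous_sqrt.tendsto _).comp ((Real.continuous_sqrt.tendsto _).comp h1)
    simp only [Real.sqrt_zero] at h2
    refine h2.congr fun k => ?_
    have h3 := h.lam_pos k
    simp only [Function.comp, hB, hq]
    rw [Real.sqrt_div (by positivity), Real.sqrt_div (by positivity),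
      show (1 + lam k) ^ 16 = (((1 + lam k) ^ 4) ^ 2) ^ 2 by ring, Real.sqrt_sq (by positivity),
      Real.sqrt_sq (by positivity)]
  refine ⟨fun k => 46 * B k + 14 * Real.exp (-(q k)), ?_, ?_⟩
  · have h1 := Real.tendsto_exp_neg_atTop_nhds_zero.comp hqT
    have := (hBT.const_mul 46).add (h1.const_mul 14)
    simpa using this
  have ev1 : ∀ᶠ k in atTop, B k ≤ 1 / 46 := hBT.eventually_le_const (by norm_num)
  have ev2 : ∀ᶠ k in atTop, 80 ≤ q k := hqT.eventually_ge_atTop 80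
  filter_upwards [ev1, ev2] with k hBk hqk φ ψ hφ hψ
  have hl := h.lam_pos k
  have hm := h.m_pos k
  have hm' : (0 : ℝ) < m k := by exact_mod_cast hm
  have hX := h.mul_lam_pos k
  have hXm := h.mul_lam_le k
  have hq0 : 0 < q k := by linarith
  have hqB : (1 + lam k) ^ 4 = B k * q k := by simp only [hB]; field_simp
  have hqm : q k ^ 4 ≤ m k := (hq4 k).trans_le hXm
  have hqm1 : q k ≤ m k := (le_self_pow₀ (by linarith) (by norm_num)).trans hqm
  have hl2 : lam k ^ 2 ≤ (1 + lam k) ^ 4 := by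
    calc lam k ^ 2 ≤ (1 + lam k) ^ 2 := by gcongr; linarith
      _ ≤ _ := pow_le_pow_right₀ (by linarith) (by norm_num)
  have hl4 : (lam k ^ 2) ^ 2 ≤ (1 + lam k) ^ 4 := by
    rw [← pow_mul]; gcongr; linarith
  have h1l : 1 ≤ (1 + lam k) ^ 4 := one_le_pow₀ (by linarith)
  have hB0 : 0 < B k := by simp only [hB]; positivity
  have d1 : lam k ^ 2 / q k ≤ B k := by simp only [hB]; gcongr
  have d2 : lam k ^ 2 / m k ≤ B k := le_trans (by gcongr) d1
  have d3 : (lam k ^ 2) ^ 2 / m k ≤ B k := by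
    simp only [hB]; gcongr
  have d4 : 1 / q k ≤ B k := by simp only [hB]; gcongr
  have hexp2 : lam k ^ 2 ≤ B k * q k := hl2.trans_eq hqB
  have hBq : B k * q k ≤ q k / 46 := by nlinarith
  set ρ := lam k ^ 2 with hρ
  have hρ0 : 0 ≤ ρ := by positivity
  set z : ℂ := lam k ^ 2 * exp ((φ + ψ) * I) with hz
  have hzρ : z = ρ * exp ((φ + ψ : ℝ) * I) := by simp only [hz, hρ]; push_cast; ring
  have hzn : ‖z‖ = ρ := by
    rw [hzρ, norm_mul, norm_exp_ofReal_mul_I, norm_real, Real.norm_of_nonneg hρ0, mul_one]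
  set G := Real.exp (-(n k * lam k / (2 * π ^ 2)) * φ ^ 2) *
        Real.exp (-(n k * lam k / (2 * π ^ 2)) * ψ ^ 2) with hG
  have hG0 : 0 < G := by positivity
  have hchi := norm_chi_mul_chi_le hl hφ hψ (n k)
  have hGG : Real.exp (-(n k * lam k / π ^ 2 * (φ ^ 2 + ψ ^ 2))) = G * G := by
    simp only [hG]
    rw [← Real.exp_add, ← Real.exp_add]
    congr 1
    field_simp
    ring
  rw [hGG] at hchi
  rw [norm_mul]
  have hG1 : G ≤ 1 := by
    rw [hG, ← Real.exp_add]
    apply Real.exp_le_one_iff.2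
    have : 0 ≤ n k * lam k / (2 * π ^ 2) * (φ ^ 2 + ψ ^ 2) := by positivity
    linarith
  have hqq : 80 * q k ≤ q k ^ 2 := by nlinarith
  by_cases hcase : |φ| ≤ 1 / q k ∧ |ψ| ≤ 1 / q k
  · have hzz : ‖z - ρ‖ ≤ (2 * (1 / q k)) * ρ := by
      have e : z - ρ = ρ * (exp (I * (φ + ψ : ℝ)) - 1) := by rw [hzρ]; ring_nf
      rw [e, norm_mul, norm_real, Real.norm_of_nonneg hρ0, mul_comm]
      gcongr
      refine (Real.norm_exp_I_mul_ofReal_sub_one_le).trans ?_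
      rw [Real.norm_eq_abs]
      exact (abs_add_le _ _).trans (by linarith [hcase.1, hcase.2])
    -- `D = 23 B` because its three terms are at most `5 B`, `2 B` and `16 B`; hence the 46 in the
    -- error and the threshold `1 / 46`.
    have hnear := norm_simpleFactor_mul_exp_sub_one_le hm (ρ := ρ) (α := 2 * (1 / q k))
      (δ := 1 / q k) (D := 23 * B k) hρ0 (by positivity) (by positivity) (by linarith)
      (by
        have : 4 * ρ / m k = 4 * (ρ / m k) := by ring
        rw [this]; linarith)
      (by
        have : (2 * (1 / q k) + 8 * (1 / q k)) * ρ / 2 + 4 * ρ / (2 * m k) + (4 * ρ) ^ 2 / m k =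
          5 * (ρ / q k) + 2 * (ρ / m k) + 16 * (ρ ^ 2 / m k) := by field_simp; ring
        rw [this]; linarith)
      (by linarith) hzz
    have hE : Real.exp (19 * ρ) * Real.exp (-(m k * (1 / q k) ^ 2 / 4)) ≤ Real.exp (-(q k)) := by
      rw [← Real.exp_add]
      apply Real.exp_le_exp.2
      have : q k ^ 2 ≤ m k * (1 / q k) ^ 2 := by
        rw [one_div, inv_pow, ← div_eq_mul_inv, le_div_iff₀ (by positivity)]
        calc _ = q k ^ 4 := by ring
          _ ≤ _ := hqm
      linarith
    have hpos := Real.exp_pos (-(q k))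
    calc _ ≤ (G * G) * (2 * (23 * B k) + 12 * Real.exp (-(q k))) := by
          refine mul_le_mul hchi (hnear.trans ?_) (norm_nonneg _) (by positivity)
          rw [mul_assoc 12]
          gcongr
      _ ≤ (G * 1) * (46 * B k + 14 * Real.exp (-(q k))) := by
          exact mul_le_mul (mul_le_mul_of_nonneg_left hG1 hG0.le) (by linarith) (by positivity)
            (by positivity)
      _ = _ := by ring
  · have hsum : 1 / q k ^ 2 ≤ φ ^ 2 + ψ ^ 2 := by
      have key : ∀ x : ℝ, 1 / q k < |x| → 1 / q k ^ 2 ≤ x ^ 2 := by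
        intro x hx
        rw [← sq_abs x, ← one_div_pow]
        gcongr
      rw [not_and_or, not_le, not_le] at hcase
      rcases hcase with hc | hc
      · linarith [key _ hc, sq_nonneg ψ]
      · linarith [key _ hc, sq_nonneg φ]
    have hGle : G ≤ Real.exp (-(q k ^ 2 / 20)) := by
      rw [hG, ← Real.exp_add]
      apply Real.exp_le_exp.2
      rw [← hq4]
      have hpi : 2 * π ^ 2 ≤ 20 := by
        have : π ^ 2 ≤ 3.15 ^ 2 := pow_le_pow_left₀ Real.pi_pos.le Real.pi_lt_d2.le 2
        norm_num at this
        linarith only [this]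
      have : q k ^ 4 / 20 * (1 / q k ^ 2) ≤ q k ^ 4 / (2 * π ^ 2) * (φ ^ 2 + ψ ^ 2) := by
        gcongr
      have e : q k ^ 4 / 20 * (1 / q k ^ 2) = q k ^ 2 / 20 := by field_simp
      linarith
    have hfar : ‖simpleFactor (m k) z * (Real.exp (ρ / 2) : ℝ) - 1‖ ≤ 2 * Real.exp (6 * ρ) := by
      refine (norm_sub_le _ _).trans ?_
      rw [norm_mul, norm_real, Real.norm_of_nonneg (Real.exp_pos _).le, norm_one]
      have h1 := norm_simpleFactor_le hm z
      rw [hzn] at h1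
      have h2 : ‖simpleFactor (m k) z‖ * Real.exp (ρ / 2) ≤ Real.exp (6 * ρ) := by
        calc _ ≤ Real.exp (5 * ρ) * Real.exp (ρ / 2) := by gcongr
          _ ≤ _ := by rw [← Real.exp_add]; apply Real.exp_le_exp.2; linarith
      have h3 : 1 ≤ Real.exp (6 * ρ) := Real.one_le_exp (by positivity)
      linarith
    have hE : Real.exp (-(q k ^ 2 / 20)) * Real.exp (6 * ρ) ≤ Real.exp (-(q k)) := by
      rw [← Real.exp_add]
      apply Real.exp_le_exp.2
      linarith
    have hpos := Real.exp_pos (-(q k))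
    calc _ ≤ (G * Real.exp (-(q k ^ 2 / 20))) * (2 * Real.exp (6 * ρ)) := by
          refine mul_le_mul (hchi.trans ?_) hfar (norm_nonneg _) (by positivity)
          gcongr
      _ = G * (2 * (Real.exp (-(q k ^ 2 / 20)) * Real.exp (6 * ρ))) := by ring
      _ ≤ G * (2 * Real.exp (-(q k))) := by gcongr
      _ ≤ G * (46 * B k + 14 * Real.exp (-(q k))) := by gcongr; linarith
      _ = _ := by ring

end Admissible

end Dicore

/-! ### Assembling the asymptotics along admissible sequences. -/

namespace Dicore

open MeasureTheory Complex Finset Filter Topology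
open scoped Real

theorem ae_circleMeasure_prod :
    ∀ᵐ p ∂(circleMeasure.prod circleMeasure), |p.1| ≤ π ∧ |p.2| ≤ π := by
  rw [circleMeasure, Measure.prod_restrict]
  refine ae_restrict_of_forall_mem (measurableSet_Ioc.prod measurableSet_Ioc) fun p hp => ?_
  exact ⟨abs_le.2 ⟨hp.1.1.le, hp.1.2⟩, abs_le.2 ⟨hp.2.1.le, hp.2.2⟩⟩

theorem integrable_exp_circleMeasure (b : ℝ) :
    Integrable (fun x : ℝ => Real.exp (-b * x ^ 2)) circleMeasure :=
  ((by fun_prop : Continuous fun x : ℝ => Real.exp (-b * x ^ 2)).integrableOn_Icc).mono_set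
    Set.Ioc_subset_Icc_self

theorem integral_exp_circleMeasure_le {b : ℝ} (hb : 0 < b) :
    ∫ x, Real.exp (-b * x ^ 2) ∂circleMeasure ≤ √(π / b) := by
  rw [← integral_gaussian]
  exact setIntegral_le_integral (integrable_exp_neg_mul_sq hb)
    (ae_of_all _ fun x => (Real.exp_pos _).le)

theorem continuous_simpleFactor (m : ℕ) : Continuous (simpleFactor m) := by
  unfold simpleFactor
  fun_prop

theorem integrable_circleMeasure_prod {f : ℝ × ℝ → ℂ} (hf : Continuous f) :
    Integrable f (circleMeasure.prod circleMeasure) := by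
  rw [circleMeasure, Measure.prod_restrict]
  refine IntegrableOn.mono_set (t := Set.Icc (-π) π ×ˢ Set.Icc (-π) π) ?_
    (Set.prod_mono Set.Ioc_subset_Icc_self Set.Ioc_subset_Icc_self)
  exact hf.continuousOn.integrableOn_compact (isCompact_Icc.prod isCompact_Icc)

namespace Admissible

variable {n m : ℕ → ℕ} {lam : ℕ → ℝ}

theorem ncard_div_formula_eq (h : Admissible n m lam) (k : ℕ) :
    (((dicores (n k) (m k)).ncard / formula (n k) (m k) (lam k) : ℝ) : ℂ) =
    (∫ p, chi (lam k) p.1 ^ n k * chi (lam k) p.2 ^ n k * exp (-(m k * (p.1 + p.2) * I)) *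
      simpleFactor (m k) (lam k ^ 2 * exp ((p.1 + p.2) * I)) ∂(circleMeasure.prod circleMeasure)) *
      (Real.exp (lam k ^ 2 / 2) : ℝ) *
      ((n k * ((m k : ℝ) / n k * (1 + lam k - m k / n k)) : ℝ) / (2 * π)) := by
  rw [← ncard_dicores_eq_integral (h.lam_pos k)]
  have hE0 : 0 < Real.exp (lam k) - 1 := by
    linarith [Real.add_one_lt_exp (h.lam_pos k).ne', h.lam_pos k]
  have hv : 0 < n k * ((m k : ℝ) / n k * (1 + lam k - m k / n k)) := by
    have := h.le_variance k; have := h.mul_lam_pos k; linarith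
  have hl := h.lam_pos k
  have hn : (0 : ℝ) < n k := by exact_mod_cast h.n_pos k
  have hf : formula (n k) (m k) (lam k) = (m k).factorial * (Real.exp (lam k) - 1) ^ (2 * n k) /
      (2 * π * (n k * ((m k : ℝ) / n k * (1 + lam k - m k / n k))) * lam k ^ (2 * m k)) *
      (Real.exp (lam k ^ 2 / 2))⁻¹ := by
    rw [formula, ← Real.exp_neg]
    congr 2
    · ring
    · ring
  rw [hf]
  set v := n k * ((m k : ℝ) / n k * (1 + lam k - m k / n k))
  have hreal : ((dicores (n k) (m k)).ncard : ℝ) / ((m k).factorial *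
      (Real.exp (lam k) - 1) ^ (2 * n k) / (2 * π * v * lam k ^ (2 * m k)) *
      (Real.exp (lam k ^ 2 / 2))⁻¹) =
      (dicores (n k) (m k)).ncard * (lam k ^ (2 * m k) / ((m k).factorial *
        (Real.exp (lam k) - 1) ^ (2 * n k))) * (2 * π) ^ 2 * Real.exp (lam k ^ 2 / 2) *
        (v / (2 * π)) := by
    have := Real.pi_pos
    field_simp
  rw [hreal]
  push_cast
  rfl

/-- The quotient splits into the squared single integral, which the local limit theorem sends to 1,
and an error. The Gaussian integrals of the error are of order `1 / (n lam)`, cancelled by the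
variance factor, which is at most `n lam`. -/
theorem tendsto_ncard_div_formula (h : Admissible n m lam) :
    Tendsto (fun k => ((dicores (n k) (m k)).ncard : ℝ) / formula (n k) (m k) (lam k)) atTop
      (𝓝 1) := by
  obtain ⟨E, hE, hbound⟩ := h.exists_error_bound
  set v : ℕ → ℝ := fun k => n k * ((m k : ℝ) / n k * (1 + lam k - m k / n k)) with hv
  have hv0 : ∀ k, 0 < v k := fun k => by
    have := h.le_variance k; have := h.mul_lam_pos k; simp only [hv]; linarith
  have hvX : ∀ k, v k ≤ n k * lam k := fun k =>
    mul_le_mul_of_nonneg_left (h.isParam k).variance_le (by positivity)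
  let P : ℕ → ℂ := fun k => ∫ φ, chi (lam k) φ ^ n k * exp (-(m k * φ * I)) ∂circleMeasure
  let W : ℕ → ℂ := fun k => ∫ p, chi (lam k) p.1 ^ n k * chi (lam k) p.2 ^ n k *
    exp (-(m k * (p.1 + p.2) * I)) * simpleFactor (m k) (lam k ^ 2 * exp ((p.1 + p.2) * I))
    ∂(circleMeasure.prod circleMeasure)
  have hmain : Tendsto (fun k => P k ^ 2 * (v k / (2 * π) : ℝ)) atTop (𝓝 1) := by
    have h1 := (h.tendsto_integral_mul_sqrt.pow 2).mul_const ((1 / (2 * π) : ℝ) : ℂ)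
    have e : ((√(2 * π) : ℝ) : ℂ) ^ 2 * ((1 / (2 * π) : ℝ) : ℂ) = 1 := by
      rw [← ofReal_pow, Real.sq_sqrt (by positivity), ← ofReal_mul, mul_one_div_cancel (by positivity),
        ofReal_one]
    rw [e] at h1
    refine h1.congr fun k => ?_
    change (P k * (√(v k) : ℝ)) ^ 2 * _ = _
    rw [mul_pow, ← ofReal_pow, Real.sq_sqrt (hv0 k).le, mul_assoc, ← ofReal_mul]
    congr 2
    ring
  have herr : Tendsto (fun k => (W k * (Real.exp (lam k ^ 2 / 2) : ℝ) - P k ^ 2) *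
      (v k / (2 * π) : ℝ)) atTop (𝓝 0) := by
    have hE2 := hE.mul_const (π ^ 2)
    rw [zero_mul] at hE2
    refine squeeze_zero_norm' ?_ hE2
    filter_upwards [hbound] with k hk
    set b := n k * lam k / (2 * π ^ 2) with hb
    have hX := h.mul_lam_pos k
    have hb0 : 0 < b := by positivity
    have hsF := continuous_simpleFactor (m k)
    have hcont : Continuous fun p : ℝ × ℝ => chi (lam k) p.1 ^ n k * chi (lam k) p.2 ^ n k *
        exp (-(m k * (p.1 + p.2) * I)) := by fun_prop
    have hcont2 : Continuous fun p : ℝ × ℝ =>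
        simpleFactor (m k) (lam k ^ 2 * exp ((p.1 + p.2) * I)) := hsF.comp (by fun_prop)
    have hP2 : P k ^ 2 = ∫ p, chi (lam k) p.1 ^ n k * chi (lam k) p.2 ^ n k *
        exp (-(m k * (p.1 + p.2) * I)) ∂(circleMeasure.prod circleMeasure) := by
      rw [sq, ← integral_prod_mul]
      congr 1 with p
      have : exp (-(m k * (p.1 + p.2) * I)) = exp (-(m k * p.1 * I)) * exp (-(m k * p.2 * I)) := by
        rw [← exp_add]; congr 1; ring
      rw [this]
      ring
    have hdiff : W k * (Real.exp (lam k ^ 2 / 2) : ℝ) - P k ^ 2 =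
        ∫ p, chi (lam k) p.1 ^ n k * chi (lam k) p.2 ^ n k *
        (simpleFactor (m k) (lam k ^ 2 * exp ((p.1 + p.2) * I)) * (Real.exp (lam k ^ 2 / 2) : ℝ) - 1) *
        exp (-(m k * (p.1 + p.2) * I)) ∂(circleMeasure.prod circleMeasure) := by
      rw [hP2, ← integral_mul_const, ← integral_sub]
      · congr 1 with p
        ring
      · exact (integrable_circleMeasure_prod (hcont.mul hcont2)).mul_const _
      · exact integrable_circleMeasure_prod hcont
    have hnorm : ‖W k * (Real.exp (lam k ^ 2 / 2) : ℝ) - P k ^ 2‖ ≤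
        ∫ p : ℝ × ℝ, E k * (Real.exp (-b * p.1 ^ 2) * Real.exp (-b * p.2 ^ 2))
          ∂(circleMeasure.prod circleMeasure) := by
      rw [hdiff]
      refine norm_integral_le_of_norm_le
        (((integrable_exp_circleMeasure b).mul_prod (integrable_exp_circleMeasure b)).const_mul _) ?_
      filter_upwards [ae_circleMeasure_prod] with p hp
      have e : exp (-(m k * (p.1 + p.2) * I)) = exp ((-(m k * (p.1 + p.2)) : ℝ) * I) := by
        congr 1; push_cast; ring
      rw [norm_mul, e, norm_exp_ofReal_mul_I, mul_one]
      exact hk p.1 p.2 hp.1 hp.2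
    rw [integral_const_mul, integral_prod_mul (fun x => Real.exp (-b * x ^ 2))
      (fun x => Real.exp (-b * x ^ 2))] at hnorm
    have hEk : 0 ≤ E k := by
      have := (norm_nonneg _).trans (hk 0 0 (by simp [Real.pi_pos.le]) (by simp [Real.pi_pos.le]))
      simpa using this
    have hI := integral_exp_circleMeasure_le hb0
    have hI0 : 0 ≤ ∫ x, Real.exp (-b * x ^ 2) ∂circleMeasure :=
      integral_nonneg fun x => (Real.exp_pos _).le
    rw [norm_mul, norm_real, Real.norm_of_nonneg (by have := hv0 k; positivity)]
    have hvk := hv0 k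
    calc _ ≤ (E k * (√(π / b) * √(π / b))) * (n k * lam k / (2 * π)) := by
          refine mul_le_mul (hnorm.trans ?_) ?_ (by positivity) (by positivity)
          · gcongr
          · have := hvX k
            gcongr
      _ = E k * π ^ 2 := by
          rw [Real.mul_self_sqrt (by positivity), hb]
          have := Real.pi_pos
          generalize n k * lam k = X at hX
          field_simp
  have hC : Tendsto (fun k => ((((dicores (n k) (m k)).ncard / formula (n k) (m k) (lam k) : ℝ)) : ℂ))
      atTop (𝓝 ((1 : ℝ) : ℂ)) := by
    have := hmain.add herr
    rw [add_zero] at this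
    rw [ofReal_one]
    refine this.congr fun k => ?_
    rw [h.ncard_div_formula_eq k]
    change _ = W k * _ * ((v k : ℝ) / (2 * π))
    push_cast
    ring
  exact tendsto_ofReal_iff.1 hC

end Admissible

theorem tendsto_div_one_add_log_pow {C : ℝ} (hC : 0 < C) :
    Tendsto (fun x : ℝ => x / (1 + C * Real.log x) ^ 16) atTop atTop := by
  have h1 : Tendsto (fun x : ℝ => Real.log x ^ 16 / x) atTop (𝓝 0) :=
    Real.isLittleO_pow_log_id_atTop.tendsto_div_nhds_zero
  have h2 : Tendsto (fun x : ℝ => (Real.log x ^ 16 / x)⁻¹) atTop atTop := by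
    refine Tendsto.inv_tendsto_nhdsGT_zero (tendsto_nhdsWithin_iff.2 ⟨h1, ?_⟩)
    filter_upwards [eventually_gt_atTop 1] with x hx
    have := Real.log_pos hx
    simp only [Set.mem_Ioi]
    positivity
  have h3 := h2.const_mul_atTop (show 0 < ((1 + C) ^ 16)⁻¹ by positivity)
  refine tendsto_atTop_mono' _ ?_ h3
  filter_upwards [Real.tendsto_log_atTop.eventually_ge_atTop 1, eventually_gt_atTop 0] with x hx hx0
  rw [inv_div]
  have : (1 + C * Real.log x) ^ 16 ≤ ((1 + C) * Real.log x) ^ 16 := by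
    gcongr; nlinarith
  calc _ = x / ((1 + C) * Real.log x) ^ 16 := by rw [mul_pow]; field_simp
    _ ≤ _ := by gcongr

/-- If `lam ≤ 1`, then `n lam ≥ m - n ≥ k` while `(1 + lam)^16 ≤ 2^16`. If `lam ≥ 1`, then `lam < c
≤ C log n`, and `n` outgrows every power of its logarithm. -/
theorem admissible_of_le_log {n m : ℕ → ℕ} {lam : ℕ → ℝ} {C : ℝ} (hC : 0 < C)
    (hn : ∀ k, k + 1 ≤ n k) (hm : ∀ k, n k + k ≤ m k)
    (hlog : ∀ k, (m k : ℝ) ≤ C * (n k * Real.log (n k)))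
    (hp : ∀ k, IsParam ((m k : ℝ) / n k) (lam k)) : Admissible n m lam := by
  refine ⟨hp, ?_⟩
  have hnT : Tendsto (fun k => (n k : ℝ)) atTop atTop :=
    tendsto_natCast_atTop_atTop.comp
      (tendsto_atTop_mono (fun k => (Nat.le_succ k).trans (hn k)) tendsto_id)
  have hT1 := (tendsto_div_one_add_log_pow hC).comp hnT
  have hT2 : Tendsto (fun k : ℕ => (k : ℝ) / 2 ^ 16) atTop atTop :=
    tendsto_natCast_atTop_atTop.atTop_div_const (by norm_num)
  rw [tendsto_atTop]
  intro b
  filter_upwards [hT1.eventually_ge_atTop b, hT2.eventually_ge_atTop b] with k h1 h2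
  have hn0 : (0 : ℝ) < n k := by
    have := hn k
    exact_mod_cast (by omega : 0 < n k)
  have hl := (hp k).1
  have hXk : (k : ℝ) ≤ n k * lam k := by
    have h3 := (hp k).le_one_add
    rw [div_le_iff₀ hn0] at h3
    have : (n k : ℝ) + k ≤ m k := by exact_mod_cast hm k
    linarith
  rcases le_total (lam k) 1 with h4 | h4
  · refine h2.trans ?_
    gcongr
    linarith
  · refine h1.trans ?_
    have h5 : lam k ≤ C * Real.log (n k) := by
      refine (hp k).lt.le.trans ?_
      rw [div_le_iff₀ hn0]
      linarith [hlog k]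
    simp only [Function.comp]
    gcongr
    exact le_mul_of_one_le_right hn0.le h4

end Dicore

/-- For `c > 1` the parameter is well defined; and for all `C, ε > 0` there are thresholds `N, R`
such that the ratio of the number of dicores to the formula is within `ε` of `1` for all
`n ≥ N` and all `m` with `m - n ≥ R` and `m ≤ C n log n`. -/
theorem theorem2 :
    (∀ c : ℝ, 1 < c → ∃! lam : ℝ, Dicore.IsParam c lam) ∧
    ∀ C : ℝ, 0 < C → ∀ ε : ℝ, 0 < ε → ∃ N R : ℕ, ∀ n m : ℕ, N ≤ n → n + R ≤ m →
      (m : ℝ) ≤ C * (n * Real.log n) →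
      ∀ lam : ℝ, Dicore.IsParam ((m : ℝ) / n) lam →
        |((Dicore.dicores n m).ncard : ℝ) / Dicore.formula n m lam - 1| < ε := by
  refine ⟨fun c hc => Dicore.existsUnique_isParam hc, fun C hC ε hε => ?_⟩
  by_contra! hcon
  -- Thresholds `N = k + 1` and `R = k` produce one counterexample for each `k`, so `n` and `m - n`
  -- both tend to infinity; the `+ 1` keeps `n` positive.
  choose n m hn hm hlog lam hp hbad using fun k : ℕ => hcon (k + 1) k
  have hadm := Dicore.admissible_of_le_log hC hn hm hlog hp
  have hev := (Metric.tendsto_nhds.1 hadm.tendsto_ncard_div_formula) ε hε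
  obtain ⟨k, hk⟩ := hev.exists
  rw [Real.dist_eq] at hk
  exact absurd hk (not_lt.2 (hbad k))
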